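/- All identities are between formal power series in $a$ and $q$ with integer coefficients; infinite sums and products are taken coefficientwise. Write $(x;y)_n=\prod_{j=0}^{n-1}(1-xy^j)$, $(x;y)_\infty=\prod_{j\ge 0}(1-xy^j)$, with $1/(q;q)_{m}=0$ for $m<0$. Let $d,k\ge 1$ and $1\le i\le k$. Let $b_{d,k,i}(m,n)$ be the number of partitions of $n$ into exactly $m$ parts in which $d$ appears at most $i-1$ times and, for every $j\ge 1$, the total number of appearances of $dj$ and $dj+d$ is at most $k-1$ (nonmultiples of $d$ are unrestricted). Put $$\mathcal B_{d,k,i}(a)=\mathcal B_{d,k,i}(a,q)=\sum_{m,n\ge 0}b_{d,k,i}(m,n)a^mq^n,$$ $$Q_{d,k,i}(a)=Q_{d,k,i}(a,q)=\frac1{(aq;q)_\infty}\sum_{n\ge 0}\frac{(-1)^na^{kn}q^{(dk+\frac d2)n^2+(k-i+\frac12)dn}(1-a^iq^{(2n+1)di})(aq^d;q^d)_n}{(q^d;q^d)_n}.$$ Then the product and the series defining $Q_{d,k,i}$ converge coefficientwise, and the following hold. 1. For all $d,k\ge 1$, both families $G_i=\mathcal B_{d,k,i}$ and $G_i=Q_{d,k,i}$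 $(1\le i\le k)$ satisfy $$G_1(a)=\frac{1}{(aq;q)_{d-1}}G_k(aq^d),\qquad G_i(a)=G_{i-1}(a)+\frac{a^{i-1}q^{(i-1)d}}{(aq;q)_{d-1}}G_{k-i+1}(aq^d)\quad(2\le i\le k),$$ and $G_i(0)=1$ for $1\le i\le k$. 2. $\mathcal B_{d,k,i}(a)=Q_{d,k,i}(a)$ for all $d,k\ge 1$ and $1\le i\le k$. 3. $\mathcal B_{d,k,i}(a)=Q_{d,k,i}(a)=F_{d,k,i}(a)$ for $(d,k)=(2,2),(2,3),(2,4),(3,3),(3,4),(3,5)$ and $1\le i\le k$, where (all sums over $n\ge 0$, and over $r\ge 0$ when $r$ occurs) - $F_{2,2,1}=\sum\frac{a^nq^{\frac32n^2+\frac32n}}{(aq;q^2)_{n+1}(q;q)_n}$, $\;F_{2,2,2}=\sum\frac{a^nq^{\frac32n^2-\frac12n}}{(aq;q^2)_n(q;q)_n}$; - $F_{2,3,1}=\sum\frac{a^nq^{n^2+2n}}{(aq;q^2)_{n+1}(q;q)_n}$, $\;F_{2,3,2}=\sum\frac{a^nq^{n^2+n}}{(aq;q^2)_{n+1}(q;q)_n}$,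 $\;F_{2,3,3}=\sum\frac{a^nq^{n^2}}{(aq;q^2)_n(q;q)_n}$; - $F_{2,4,1}=\sum\frac{a^{n+r}q^{n^2+2n+2r^2+2r}}{(aq;q^2)_{n+1}(q;q)_{n-2r}(q^2;q^2)_r}$, $\;F_{2,4,2}=\sum\frac{a^{n+r}q^{n^2+2n+2r^2+2r}(1+aq^{2r+2})}{(aq;q^2)_{n+1}(q;q)_{n-2r}(q^2;q^2)_r}$, $\;F_{2,4,3}=\sum\frac{a^{n+r}q^{n^2+2r^2+2r}}{(aq;q^2)_n(q;q)_{n-2r}(q^2;q^2)_r}$, $\;F_{2,4,4}=\sum\frac{a^{n+r}q^{n^2+2r^2}}{(aq;q^2)_n(q;q)_{n-2r}(q^2;q^2)_r}$; - $F_{3,3,1}=\sum\frac{(-1)^ra^nq^{n^2+3n+3r(r-1)/2}(aq^3;q^3)_{n-r}}{(aq;q)_{2n+2}(q;q)_{n-3r}(q^3;q^3)_r}$, $\;F_{3,3,2}=\sum\frac{(-1)^ra^{n-1}q^{n^2+3r(r-3)/2}(a;q^3)_{n-r}(1+aq^{3r}-q^{3r})}{(a;q)_{2n}(q;q)_{n-3r}(q^3;q^3)_r}$,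 $\;F_{3,3,3}=\sum\frac{(-1)^ra^nq^{n^2+3r(r-1)/2}(a;q^3)_{n-r}}{(a;q)_{2n}(q;q)_{n-3r}(q^3;q^3)_r}$; - $F_{3,4,1}=\sum\frac{a^nq^{n(n+3)}(aq^3;q^3)_n}{(aq;q)_{2n+2}(q;q)_n}$, $\;F_{3,4,2}=\sum\frac{a^nq^{n(n+2)}(aq^3;q^3)_n}{(aq;q)_{2n+2}(q;q)_n}$, $\;F_{3,4,3}=\sum\frac{a^nq^{n(n+1)}(aq^3;q^3)_n}{(aq;q)_{2n+1}(q;q)_n}$, $\;F_{3,4,4}=\sum\frac{a^nq^{n^2}(a;q^3)_n}{(a;q)_{2n}(q;q)_n}$; - $F_{3,5,1}=\sum\frac{a^{n+r}q^{n^2+3r^2+3n+3r}(aq^3;q^3)_{n-r}}{(aq;q)_{2n+2}(q;q)_{n-3r}(q^3;q^3)_r}$, $\;F_{3,5,2}=\sum\frac{a^{n+r}q^{n^2+3r^2+3n+3r}(aq^3;q^3)_{n-r}(1+aq^{3r+3})}{(aq;q)_{2n+2}(q;q)_{n-3r}(q^3;q^3)_r}$, $\;F_{3,5,3}=\sum\frac{a^{n+r-1}q^{n^2+3r^2-3}(a;q^3)_{n-r}(q^{3r}+aq^{6r+3}-1)}{(a;q)_{2n}(q;q)_{n-3r}(q^3;q^3)_r}$,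 $\;F_{3,5,4}=\sum\frac{a^{n+r}q^{n^2+3r^2+3r}(a;q^3)_{n-r}}{(a;q)_{2n}(q;q)_{n-3r}(q^3;q^3)_r}$, $\;F_{3,5,5}=\sum\frac{a^{n+r}q^{n^2+3r^2}(a;q^3)_{n-r}}{(a;q)_{2n}(q;q)_{n-3r}(q^3;q^3)_r}$. -/

import Mathlib

open scoped PowerSeries PowerSeries.WithPiTopology

noncomputable section

namespace GenGordon

/-- Formal double power series in `a` and `q` over `ℤ`, viewed as power series in `a` whose
coefficients are power series in `q`. Infinite sums and products are taken coefficientwise,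
that is, in the product topology. -/
abbrev DSeries : Type := PowerSeries (PowerSeries ℤ)

/-- The variable `a`. -/
def a : DSeries := PowerSeries.X

/-- The variable `q`. -/
def q : DSeries := PowerSeries.C (PowerSeries.X : PowerSeries ℤ)

/-- The substitution `f(a, q) ↦ f(a q^d, q)`. -/
def shift (d : ℕ) (f : DSeries) : DSeries :=
  PowerSeries.rescale ((PowerSeries.X : PowerSeries ℤ) ^ d) f

/-- The substitution `f(a, q) ↦ f(0, q)`. -/
def atZero (f : DSeries) : PowerSeries ℤ := PowerSeries.constantCoeff f

/-- The rising `q`-factorial `(x; y)_n = (1 - x)(1 - x y) ⋯ (1 - x y^(n-1))`. -/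
def poch (x y : DSeries) (n : ℕ) : DSeries := ∏ j ∈ Finset.range n, (1 - x * y ^ j)

/-- The reciprocal `1 / (x; y)_n`; it is only used where `(x; y)_n` is invertible. -/
def invPoch (x y : DSeries) (n : ℕ) : DSeries := Ring.inverse (poch x y n)

/-- The infinite product `(x; y)_∞`. -/
def pochInf (x y : DSeries) : DSeries := ∏' j : ℕ, (1 - x * y ^ j)

/-! ### Partitions -/

/-- The partitions `p` in which `d` appears at most `i - 1` times, and in which any two
consecutive positive multiples of `d` together appear at most `k - 1` times; there is no
restriction on the parts that are not multiples of `d`. -/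
def IsGordon (d k i : ℕ) {n : ℕ} (p : n.Partition) : Prop :=
  p.parts.count d ≤ i - 1 ∧
    ∀ j : ℕ, 1 ≤ j → p.parts.count (d * j) + p.parts.count (d * j + d) ≤ k - 1

open Classical in
/-- The number of such partitions of `n` with exactly `m` parts. -/
def b (d k i m n : ℕ) : ℕ :=
  (Finset.univ.filter fun p : n.Partition =>
    IsGordon d k i p ∧ Multiset.card p.parts = m).card

/-- The generating function `∑_{m, n ≥ 0} b_{d,k,i}(m, n) a^m q^n`. -/
def B (d k i : ℕ) : DSeries :=
  PowerSeries.mk fun m => PowerSeries.mk fun n => (b d k i m n : ℤ)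

/-! ### The functions `Q_{d,k,i}` -/

/-- The `n`-th term of the series in `Q_{d,k,i}`. The exponent of `q` is
`(dk + d/2) n^2 + (k - i + 1/2) d n`. -/
def QTerm (d k i n : ℕ) : DSeries :=
  (-1) ^ n * a ^ (k * n) * q ^ (((2 * d * k + d) * n ^ 2 + (2 * (k - i) + 1) * d * n) / 2) *
    (1 - a ^ i * q ^ ((2 * n + 1) * d * i)) * poch (a * q ^ d) (q ^ d) n *
    invPoch (q ^ d) (q ^ d) n

/-- `Q_{d,k,i}(a, q)`. -/
def Q (d k i : ℕ) : DSeries :=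
  Ring.inverse (pochInf (a * q) q) * ∑' n : ℕ, QTerm d k i n

/-! ### The `q`-difference system -/

/-- `G_1, …, G_k` satisfy
`G_1(a) = G_k(a q^d) / (aq; q)_{d-1}` and, for `2 ≤ i ≤ k`,
`G_i(a) = G_{i-1}(a) + a^(i-1) q^((i-1)d) G_{k-i+1}(a q^d) / (aq; q)_{d-1}`. -/
def QDiffSystem (d k : ℕ) (G : ℕ → DSeries) : Prop :=
  G 1 = invPoch (a * q) q (d - 1) * shift d (G k) ∧
    ∀ i : ℕ, 2 ≤ i → i ≤ k →
      G i = G (i - 1) +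
        a ^ (i - 1) * q ^ ((i - 1) * d) * invPoch (a * q) q (d - 1) * shift d (G (k - i + 1))

/-- The initial values `G_i(0) = 1` for `1 ≤ i ≤ k`. -/
def InitialValues (k : ℕ) (G : ℕ → DSeries) : Prop :=
  ∀ i : ℕ, 1 ≤ i → i ≤ k → atZero (G i) = 1

/-! ### The functions `F_{d,k,i}`

In the double sums, `1 / (q; q)_{n - d r}` is zero for `d r > n`, by the usual convention, so
that the inner sum runs over `0 ≤ r ≤ n / d`. -/

def F221 : DSeries :=
  ∑' n : ℕ, a ^ n * q ^ ((3 * n ^ 2 + 3 * n) / 2) * invPoch (a * q) (q ^ 2) (n + 1) *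
    invPoch q q n

def F222 : DSeries :=
  ∑' n : ℕ, a ^ n * q ^ ((3 * n ^ 2 - n) / 2) * invPoch (a * q) (q ^ 2) n * invPoch q q n

def F231 : DSeries :=
  ∑' n : ℕ, a ^ n * q ^ (n ^ 2 + 2 * n) * invPoch (a * q) (q ^ 2) (n + 1) * invPoch q q n

def F232 : DSeries :=
  ∑' n : ℕ, a ^ n * q ^ (n ^ 2 + n) * invPoch (a * q) (q ^ 2) (n + 1) * invPoch q q n

def F233 : DSeries :=
  ∑' n : ℕ, a ^ n * q ^ (n ^ 2) * invPoch (a * q) (q ^ 2) n * invPoch q q n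

def F241 : DSeries :=
  ∑' n : ℕ, ∑ r ∈ Finset.range (n / 2 + 1),
    a ^ (n + r) * q ^ (n ^ 2 + 2 * n + 2 * r ^ 2 + 2 * r) *
      invPoch (a * q) (q ^ 2) (n + 1) * invPoch q q (n - 2 * r) * invPoch (q ^ 2) (q ^ 2) r

def F242 : DSeries :=
  ∑' n : ℕ, ∑ r ∈ Finset.range (n / 2 + 1),
    a ^ (n + r) * q ^ (n ^ 2 + 2 * n + 2 * r ^ 2 + 2 * r) * (1 + a * q ^ (2 * r + 2)) *
      invPoch (a * q) (q ^ 2) (n + 1) * invPoch q q (n - 2 * r) * invPoch (q ^ 2) (q ^ 2) r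

def F243 : DSeries :=
  ∑' n : ℕ, ∑ r ∈ Finset.range (n / 2 + 1),
    a ^ (n + r) * q ^ (n ^ 2 + 2 * r ^ 2 + 2 * r) *
      invPoch (a * q) (q ^ 2) n * invPoch q q (n - 2 * r) * invPoch (q ^ 2) (q ^ 2) r

def F244 : DSeries :=
  ∑' n : ℕ, ∑ r ∈ Finset.range (n / 2 + 1),
    a ^ (n + r) * q ^ (n ^ 2 + 2 * r ^ 2) *
      invPoch (a * q) (q ^ 2) n * invPoch q q (n - 2 * r) * invPoch (q ^ 2) (q ^ 2) r

def F331 : DSeries :=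
  ∑' n : ℕ, ∑ r ∈ Finset.range (n / 3 + 1),
    (-1) ^ r * a ^ n * q ^ (n ^ 2 + 3 * n + 3 * r * (r - 1) / 2) *
      poch (a * q ^ 3) (q ^ 3) (n - r) * invPoch (a * q) q (2 * n + 2) *
      invPoch q q (n - 3 * r) * invPoch (q ^ 3) (q ^ 3) r

/-- The monomial factor `a^(n-1) q^(n^2 + 3r(r-3)/2) (1 + a q^(3r) - q^(3r))`, expanded so that
no negative power of `a` occurs for `n = r = 0`; see `a_mul_mono332`. -/
def mono332 (n r : ℕ) : DSeries :=
  a ^ n * q ^ ((2 * n ^ 2 + 3 * r ^ 2 - 9 * r) / 2 + 3 * r) +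
    a ^ (n - 1) * q ^ ((2 * n ^ 2 + 3 * r ^ 2 - 9 * r) / 2) * (1 - q ^ (3 * r))

/-- `mono332 n r` is `a⁻¹ a^n q^(n^2 + 3r(r-3)/2) (1 + a q^(3r) - q^(3r))`. -/
theorem a_mul_mono332 (n r : ℕ) (h : 3 * r ≤ n) :
    a * mono332 n r =
      a ^ n * q ^ ((2 * n ^ 2 + 3 * r ^ 2 - 9 * r) / 2) * (1 + a * q ^ (3 * r) - q ^ (3 * r)) := by
  unfold mono332
  rcases Nat.eq_zero_or_pos n with rfl | hn
  · obtain rfl : r = 0 := by omega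
    simp
  · obtain ⟨m, rfl⟩ : ∃ m, n = m + 1 := ⟨n - 1, by omega⟩
    rw [Nat.add_sub_cancel, pow_add q _ (3 * r)]
    ring

def F332 : DSeries :=
  ∑' n : ℕ, ∑ r ∈ Finset.range (n / 3 + 1),
    (-1) ^ r * mono332 n r * poch a (q ^ 3) (n - r) * invPoch a q (2 * n) *
      invPoch q q (n - 3 * r) * invPoch (q ^ 3) (q ^ 3) r

def F333 : DSeries :=
  ∑' n : ℕ, ∑ r ∈ Finset.range (n / 3 + 1),
    (-1) ^ r * a ^ n * q ^ (n ^ 2 + 3 * r * (r - 1) / 2) *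
      poch a (q ^ 3) (n - r) * invPoch a q (2 * n) *
      invPoch q q (n - 3 * r) * invPoch (q ^ 3) (q ^ 3) r

def F341 : DSeries :=
  ∑' n : ℕ, a ^ n * q ^ (n * (n + 3)) * poch (a * q ^ 3) (q ^ 3) n *
    invPoch (a * q) q (2 * n + 2) * invPoch q q n

def F342 : DSeries :=
  ∑' n : ℕ, a ^ n * q ^ (n * (n + 2)) * poch (a * q ^ 3) (q ^ 3) n *
    invPoch (a * q) q (2 * n + 2) * invPoch q q n

def F343 : DSeries :=
  ∑' n : ℕ, a ^ n * q ^ (n * (n + 1)) * poch (a * q ^ 3) (q ^ 3) n *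
    invPoch (a * q) q (2 * n + 1) * invPoch q q n

def F344 : DSeries :=
  ∑' n : ℕ, a ^ n * q ^ (n ^ 2) * poch a (q ^ 3) n * invPoch a q (2 * n) * invPoch q q n

def F351 : DSeries :=
  ∑' n : ℕ, ∑ r ∈ Finset.range (n / 3 + 1),
    a ^ (n + r) * q ^ (n ^ 2 + 3 * r ^ 2 + 3 * n + 3 * r) *
      poch (a * q ^ 3) (q ^ 3) (n - r) * invPoch (a * q) q (2 * n + 2) *
      invPoch q q (n - 3 * r) * invPoch (q ^ 3) (q ^ 3) r

def F352 : DSeries :=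
  ∑' n : ℕ, ∑ r ∈ Finset.range (n / 3 + 1),
    a ^ (n + r) * q ^ (n ^ 2 + 3 * r ^ 2 + 3 * n + 3 * r) *
      poch (a * q ^ 3) (q ^ 3) (n - r) * (1 + a * q ^ (3 * r + 3)) *
      invPoch (a * q) q (2 * n + 2) * invPoch q q (n - 3 * r) * invPoch (q ^ 3) (q ^ 3) r

/-- The monomial factor `a^(n+r-1) q^(n^2 + 3r^2 - 3) (q^(3r) + a q^(6r+3) - 1)`, expanded so
that no negative power of `a` or `q` occurs for `r = 0`; see `a_mul_mono353`. -/
def mono353 (n r : ℕ) : DSeries :=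
  a ^ (n + r) * q ^ (n ^ 2 + 3 * r ^ 2 + 6 * r) -
    a ^ (n + r - 1) * q ^ (n ^ 2 + 3 * r ^ 2 - 3) * (1 - q ^ (3 * r))

/-- `mono353 n r` is `a⁻¹ q⁻³ a^(n+r) q^(n^2 + 3r^2) (q^(3r) + a q^(6r+3) - 1)`. -/
theorem a_mul_mono353 (n r : ℕ) :
    a * q ^ 3 * mono353 n r =
      a ^ (n + r) * q ^ (n ^ 2 + 3 * r ^ 2) * (q ^ (3 * r) + a * q ^ (6 * r + 3) - 1) := by
  unfold mono353
  rcases Nat.eq_zero_or_pos r with rfl | hr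
  · simp
    ring
  · obtain ⟨s, rfl⟩ : ∃ s, r = s + 1 := ⟨r - 1, by omega⟩
    have h1 : n + (s + 1) - 1 = n + s := by omega
    have h2 : n ^ 2 + 3 * (s + 1) ^ 2 - 3 = n ^ 2 + 3 * s ^ 2 + 6 * s := by
      have : n ^ 2 + 3 * (s + 1) ^ 2 = n ^ 2 + 3 * s ^ 2 + 6 * s + 3 := by ring
      omega
    rw [h1, h2]
    ring

def F353 : DSeries :=
  ∑' n : ℕ, ∑ r ∈ Finset.range (n / 3 + 1),
    mono353 n r * poch a (q ^ 3) (n - r) * invPoch a q (2 * n) *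
      invPoch q q (n - 3 * r) * invPoch (q ^ 3) (q ^ 3) r

def F354 : DSeries :=
  ∑' n : ℕ, ∑ r ∈ Finset.range (n / 3 + 1),
    a ^ (n + r) * q ^ (n ^ 2 + 3 * r ^ 2 + 3 * r) *
      poch a (q ^ 3) (n - r) * invPoch a q (2 * n) *
      invPoch q q (n - 3 * r) * invPoch (q ^ 3) (q ^ 3) r

def F355 : DSeries :=
  ∑' n : ℕ, ∑ r ∈ Finset.range (n / 3 + 1),
    a ^ (n + r) * q ^ (n ^ 2 + 3 * r ^ 2) *
      poch a (q ^ 3) (n - r) * invPoch a q (2 * n) *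
      invPoch q q (n - 3 * r) * invPoch (q ^ 3) (q ^ 3) r

/-- `F_{d,k,i}(a, q)` for `(d, k) = (2,2), (2,3), (2,4), (3,3), (3,4), (3,5)` and
`1 ≤ i ≤ k`; the value `0` elsewhere is never used. -/
def F : ℕ → ℕ → ℕ → DSeries
  | 2, 2, 1 => F221
  | 2, 2, 2 => F222
  | 2, 3, 1 => F231
  | 2, 3, 2 => F232
  | 2, 3, 3 => F233
  | 2, 4, 1 => F241
  | 2, 4, 2 => F242
  | 2, 4, 3 => F243
  | 2, 4, 4 => F244
  | 3, 3, 1 => F331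
  | 3, 3, 2 => F332
  | 3, 3, 3 => F333
  | 3, 4, 1 => F341
  | 3, 4, 2 => F342
  | 3, 4, 3 => F343
  | 3, 4, 4 => F344
  | 3, 5, 1 => F351
  | 3, 5, 2 => F352
  | 3, 5, 3 => F353
  | 3, 5, 4 => F354
  | 3, 5, 5 => F355
  | _, _, _ => 0

end GenGordon

end

/-!
The system `G_1(a) = G_k(a q^d) / (aq; q)_(d-1)`,
`G_i(a) = G_(i-1)(a) + a^(i-1) q^((i-1)d) G_(k-i+1)(a q^d) / (aq; q)_(d-1)` has at most one solution
with `G_i(0) = 1` (`QDiffSystem.unique`): modulo coefficients of lower order, all `G_i` have the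
same coefficient `c` of `a^m`, and the first equation reads `c = q^(dm) c`. So it suffices to show that
each of the three families solves it.

* Partitions. The partitions counted by `B d k i` but not by `B d k (i - 1)` contain `d` exactly
  `i - 1` times. Deleting all parts up to `d` and subtracting `d` from the others leaves a partition
  counted by `B d k (k - i + 1)`; the deleted parts below `d` are arbitrary and account for
  `1 / (aq; q)_(d-1)`. The operation is carried out as `d` steps, each of which deletes the parts
  equal to `1` and subtracts `1` from the others (`gf_tail`, `gf_count_one`).

* The functions `Q`. In the difference of the series for `i` and `i - 1` the factor
  `1 - a^i q^((2n+1)di)` is regrouped into a multiple of `1 - q^(dn)` and a multiple of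
  `1 - a q^(d(n+1))`; the first part, moved by one index, and the second part combine to the series
  for `k - i + 1` at `a q^d` (`QTerm_sub_sub`).

* The functions `F` given by single sums. The summand of
  `F_i(a) - F_(i-1)(a) - a^(i-1) q^((i-1)d) F_(k-i+1)(a q^d) / (aq; q)_(d-1)` has the form
  `U n - U (n + 1)` with `U 0 = 0`, where `U n` is `1 - q^n` times a polynomial in `a, q, q^n` times
  the summand of `F_k`, up to factors of the infinite product.

* The functions `F` given by double sums. Put `n = m + dr`. For fixed `r` the sum over `m` is a
  function of the case `(2, 3)` or `(3, 4)` at `a q^(2dr)`, so that every `F_(d,k,i)` with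
  `(d, k) = (2, 4), (3, 3), (3, 5)` is a single sum over `r` of the shape `rTerm`. The equations now
  telescope in `r`: with `y = q^(dr)`, the function `U r` is `1 - y` times a combination of the
  functions `G_j(a y^2)` of the smaller case, and the system for the `G_j`, used twice, expresses
  everything that occurs through the `G_j(a y^2 q^(2d))`, whose coefficients then agree.
-/

namespace GenGordon

/-! ### Units, shifts and convergence in the ring of double series -/

/-- The coefficient of `a^0 q^0`, as a ring homomorphism. -/
noncomputable def coeffZero : DSeries →+* ℤ :=
  (PowerSeries.constantCoeff (R := ℤ)).comp (PowerSeries.constantCoeff (R := PowerSeries ℤ))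

@[simp] lemma coeffZero_a : coeffZero a = 0 := by simp [coeffZero, a]

@[simp] lemma coeffZero_q : coeffZero q = 0 := by simp [coeffZero, q]

lemma isUnit_of_coeffZero {f : DSeries} (h : coeffZero f = 1) : IsUnit f := by
  rw [PowerSeries.isUnit_iff_constantCoeff, PowerSeries.isUnit_iff_constantCoeff]
  have : PowerSeries.constantCoeff (PowerSeries.constantCoeff f) = 1 := h
  rw [this]
  exact isUnit_one

lemma isUnit_poch {x : DSeries} (y : DSeries) (hx : coeffZero x = 0) (n : ℕ) :
    IsUnit (poch x y n) :=
  isUnit_of_coeffZero (by simp [poch, map_prod, hx])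

lemma poch_mul_invPoch {x : DSeries} (y : DSeries) (hx : coeffZero x = 0) (n : ℕ) :
    poch x y n * invPoch x y n = 1 :=
  Ring.mul_inverse_cancel _ (isUnit_poch y hx n)

@[simp] lemma poch_zero (x y : DSeries) : poch x y 0 = 1 := by simp [poch]

@[simp] lemma invPoch_zero (x y : DSeries) : invPoch x y 0 = 1 := by simp [invPoch]

lemma poch_succ (x y : DSeries) (n : ℕ) : poch x y (n + 1) = poch x y n * (1 - x * y ^ n) :=
  Finset.prod_range_succ _ _

lemma poch_succ' (x y : DSeries) (n : ℕ) :
    poch x y (n + 1) = (1 - x) * poch (x * y) y n := by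
  simp only [poch, Finset.prod_range_succ', pow_zero, mul_one]
  rw [mul_comm]
  congr 1
  refine Finset.prod_congr rfl fun j _ => ?_
  ring

lemma poch_add (x y : DSeries) (m n : ℕ) :
    poch x y (m + n) = poch x y m * poch (x * y ^ m) y n := by
  simp only [poch, Finset.prod_range_add]
  congr 1
  refine Finset.prod_congr rfl fun j _ => ?_
  ring

/-- The inverse of a product, characterised by the defining equation. -/
lemma invPoch_eq_of_mul_eq_one {x y g : DSeries} {n : ℕ} (h : poch x y n * g = 1) :
    invPoch x y n = g := by
  have hu : IsUnit (poch x y n) := IsUnit.of_mul_eq_one _ h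
  rw [← mul_one (invPoch x y n), ← h, invPoch, ← mul_assoc, Ring.inverse_mul_cancel _ hu, one_mul]

lemma invPoch_succ {x : DSeries} (y : DSeries) (hx : coeffZero x = 0) (n : ℕ) :
    (1 - x * y ^ n) * invPoch x y (n + 1) = invPoch x y n := by
  symm
  apply invPoch_eq_of_mul_eq_one
  rw [← mul_assoc, ← poch_succ, poch_mul_invPoch y hx]

lemma invPoch_succ' {x : DSeries} (y : DSeries) (hx : coeffZero x = 0) (n : ℕ) :
    (1 - x) * invPoch x y (n + 1) = invPoch (x * y) y n := by
  symm
  apply invPoch_eq_of_mul_eq_one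
  rw [← mul_assoc, mul_comm (poch _ _ _), ← poch_succ', poch_mul_invPoch y hx]

lemma invPoch_add {x : DSeries} (y : DSeries) (hx : coeffZero x = 0) (m n : ℕ) :
    invPoch x y (m + n) = invPoch x y m * invPoch (x * y ^ m) y n := by
  apply invPoch_eq_of_mul_eq_one
  have h1 := poch_mul_invPoch y hx m
  have h2 := poch_mul_invPoch (x := x * y ^ m) y (by simp [hx]) n
  rw [poch_add]
  linear_combination h2 * (poch x y m * invPoch x y m) + h1

/-! ### The substitution `a ↦ a q^d` -/

/-- The substitution `a ↦ a q^d` as a ring homomorphism. -/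
noncomputable def shiftHom (d : ℕ) : DSeries →+* DSeries :=
  PowerSeries.rescale ((PowerSeries.X : PowerSeries ℤ) ^ d)

lemma shiftHom_apply (d : ℕ) (f : DSeries) : shiftHom d f = shift d f := rfl

lemma coeff_shift (d m : ℕ) (f : DSeries) :
    PowerSeries.coeff m (shift d f) =
      (PowerSeries.X : PowerSeries ℤ) ^ (d * m) * PowerSeries.coeff m f := by
  rw [shift, PowerSeries.coeff_rescale, ← pow_mul]

@[simp] lemma shift_a (d : ℕ) : shift d a = a * q ^ d := by
  rw [shift, a, PowerSeries.rescale_X, q, ← map_pow, mul_comm]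

@[simp] lemma shift_q (d : ℕ) : shift d q = q := by
  ext m : 1
  rw [coeff_shift, q, PowerSeries.coeff_C]
  split_ifs with h <;> simp [h]

@[simp] lemma shift_add (d : ℕ) (f g : DSeries) : shift d (f + g) = shift d f + shift d g :=
  map_add (shiftHom d) f g

@[simp] lemma shift_sub (d : ℕ) (f g : DSeries) : shift d (f - g) = shift d f - shift d g :=
  map_sub (shiftHom d) f g

@[simp] lemma shift_neg (d : ℕ) (f : DSeries) : shift d (-f) = -shift d f :=
  map_neg (shiftHom d) f

@[simp] lemma shift_mul (d : ℕ) (f g : DSeries) : shift d (f * g) = shift d f * shift d g :=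
  map_mul (shiftHom d) f g

@[simp] lemma shift_pow (d : ℕ) (f : DSeries) (n : ℕ) : shift d (f ^ n) = shift d f ^ n :=
  map_pow (shiftHom d) f n

@[simp] lemma shift_one (d : ℕ) : shift d 1 = 1 := map_one (shiftHom d)

@[simp] lemma shift_zero (f : DSeries) : shift 0 f = f := by
  ext m : 1
  simp [coeff_shift]

lemma shift_shift (d e : ℕ) (f : DSeries) : shift d (shift e f) = shift (d + e) f := by
  ext m : 1
  rw [coeff_shift, coeff_shift, coeff_shift, ← mul_assoc, ← pow_add, add_mul]

lemma shift_poch (d : ℕ) (x y : DSeries) (n : ℕ) :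
    shift d (poch x y n) = poch (shift d x) (shift d y) n := by
  rw [poch, ← shiftHom_apply, map_prod]
  simp [shiftHom_apply, poch]

lemma shift_invPoch (d : ℕ) {x : DSeries} (y : DSeries) (hx : coeffZero x = 0) (n : ℕ) :
    shift d (invPoch x y n) = invPoch (shift d x) (shift d y) n := by
  symm
  apply invPoch_eq_of_mul_eq_one
  rw [← shift_poch, ← shift_mul, poch_mul_invPoch y hx, shift_one]

lemma continuous_shift (d : ℕ) : Continuous (shift d) := by
  refine (continuous_pi fun i => ?_ : Continuous (fun f : DSeries => (shift d f : (Unit →₀ ℕ) → _)))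
  have h : (fun f : DSeries => (shift d f : (Unit →₀ ℕ) → PowerSeries ℤ) i) =
      fun f : DSeries =>
        (PowerSeries.X : PowerSeries ℤ) ^ (d * i ()) * PowerSeries.coeff (i ()) f := by
    funext f
    rw [← coeff_shift]
    have : i = Finsupp.single () (i ()) := by ext; simp
    conv_lhs => rw [this]
    rfl
  rw [h]
  exact continuous_const.mul (PowerSeries.WithPiTopology.continuous_coeff _ _)

lemma hasSum_shift {ι : Type*} {f : ι → DSeries} {s : DSeries} (h : HasSum f s) (d : ℕ) :
    HasSum (fun i => GenGordon.shift d (f i)) (GenGordon.shift d s) :=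
  h.map (shiftHom d) (continuous_shift d)

/-! ### Convergence criteria -/

/-- A family is summable if its members are divisible by powers of `a` that tend to infinity. -/
lemma summable_of_a_pow_dvd {ι : Type*} {f : ι → DSeries} (φ : ι → ℕ)
    (hφ : ∀ N, {i | φ i ≤ N}.Finite) (h : ∀ i, a ^ φ i ∣ f i) : Summable f := by
  rw [PowerSeries.WithPiTopology.summable_iff_summable_coeff]
  intro m
  refine summable_of_hasFiniteSupport ((hφ m).subset fun i hi => ?_)
  by_contra hlt
  exact hi (PowerSeries.X_pow_dvd_iff.1 (h i) m (not_le.1 hlt))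

/-- A family is summable if its members are divisible by powers of `q` that tend to infinity. -/
lemma summable_of_q_pow_dvd {ι : Type*} {f : ι → DSeries} (φ : ι → ℕ)
    (hφ : ∀ N, {i | φ i ≤ N}.Finite) (h : ∀ i, q ^ φ i ∣ f i) : Summable f := by
  rw [PowerSeries.WithPiTopology.summable_iff_summable_coeff]
  intro m
  rw [PowerSeries.WithPiTopology.summable_iff_summable_coeff]
  intro n
  refine summable_of_hasFiniteSupport ((hφ n).subset fun i hi => ?_)
  by_contra hlt
  refine hi ?_
  obtain ⟨g, hg⟩ := h i
  have : PowerSeries.coeff m (f i) = PowerSeries.X ^ φ i * PowerSeries.coeff m g := by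
    rw [hg, q, ← map_pow, PowerSeries.coeff_C_mul]
  exact PowerSeries.X_pow_dvd_iff.1 ⟨_, this⟩ n (not_le.1 hlt)

lemma summable_nat_of_a_pow_dvd {f : ℕ → DSeries} (h : ∀ n, a ^ n ∣ f n) : Summable f :=
  summable_of_a_pow_dvd id (fun N => Set.finite_Iic N) h

/-- A telescoping series with vanishing first term. -/
lemma hasSum_sub_succ {U : ℕ → DSeries} (hU : Summable U) (h0 : U 0 = 0) :
    HasSum (fun n => U n - U (n + 1)) 0 := by
  have h1 : HasSum (fun n => U (n + 1)) (∑' n, U n) := by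
    have := hU.hasSum
    rw [← hasSum_nat_add_iff' 1] at this
    simpa [h0] using this
  simpa using hU.hasSum.sub h1

/-! ### The system determines its solution -/

/-- A solution of the system is determined by its initial values: comparing coefficients of
`a^m`, all `G_i` have the same coefficient `c` up to lower order data, and the first equation
gives `c = q^(dm) c` up to lower order data. -/
theorem QDiffSystem.unique {d k : ℕ} (hd : 1 ≤ d) {G H : ℕ → DSeries}
    (hG : QDiffSystem d k G) (hH : QDiffSystem d k H)
    (hG0 : InitialValues k G) (hH0 : InitialValues k H) {i : ℕ} (hi : 1 ≤ i) (hik : i ≤ k) :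
    G i = H i := by
  set D : ℕ → DSeries := fun i => G i - H i with hD
  have hk : 1 ≤ k := hi.trans hik
  have key : ∀ m i, 1 ≤ i → i ≤ k → a ^ m ∣ D i := by
    intro m
    induction m with
    | zero => intro i _ _; simp
    | succ m ih =>
      have hsh : ∀ i, 1 ≤ i → i ≤ k → a ^ m ∣ shift d (D i) := by
        intro i h1 h2
        obtain ⟨g, hg⟩ := ih i h1 h2
        rw [hg, shift_mul, shift_pow, shift_a, mul_pow, mul_assoc]
        exact Dvd.intro _ rfl
      have step : ∀ i, 2 ≤ i → i ≤ k → a ^ (m + 1) ∣ D i - D (i - 1) := by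
        intro i h2 hi
        have : D i - D (i - 1) = a * a ^ (i - 2) * q ^ ((i - 1) * d) * invPoch (a * q) q (d - 1) *
            shift d (D (k - i + 1)) := by
          have e : a ^ (i - 1) = a * a ^ (i - 2) := by rw [← pow_succ']; congr 1; omega
          simp only [hD]
          rw [hG.2 i h2 hi, hH.2 i h2 hi, e, shift_sub]
          ring
        rw [this]
        obtain ⟨g, hg⟩ := hsh (k - i + 1) (by omega) (by omega)
        rw [hg]
        exact ⟨a ^ (i - 2) * q ^ ((i - 1) * d) * invPoch (a * q) q (d - 1) * g, by ring⟩
      have all : ∀ i, 1 ≤ i → i ≤ k → a ^ (m + 1) ∣ D i - D 1 := by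
        intro i h1
        induction i, h1 using Nat.le_induction with
        | base => intro _; simp
        | succ i h1 ih' =>
          intro h2
          have h3 := step (i + 1) (by omega) h2
          have := dvd_add h3 (ih' (by omega))
          simpa using this
      have one : a ^ (m + 1) ∣ D 1 := by
        rw [a, PowerSeries.X_pow_dvd_iff]
        intro j hj
        rcases Nat.lt_succ_iff_lt_or_eq.1 hj with hj | rfl
        · exact PowerSeries.X_pow_dvd_iff.1 (ih 1 le_rfl hk) j hj
        rcases Nat.eq_zero_or_pos j with rfl | hj0
        · have h1 := hG0 1 le_rfl hk
          have h2 := hH0 1 le_rfl hk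
          rw [atZero] at h1 h2
          simp [hD, h1, h2]
        -- comparing the coefficients of `a^j` on both sides of the first equation
        obtain ⟨g, hg⟩ := ih k hk le_rfl
        have e1 : D 1 = a ^ j * ((invPoch (a * q) q (d - 1)) * (q ^ (d * j) * shift d g)) := by
          have : D 1 = invPoch (a * q) q (d - 1) * shift d (D k) := by
            simp only [hD]
            rw [hG.1, hH.1, shift_sub]
            ring
          rw [this, hg, shift_mul, shift_pow, shift_a, mul_pow, ← pow_mul]
          ring
        have c1 : PowerSeries.coeff j (D 1) = PowerSeries.X ^ (d * j) *
            PowerSeries.constantCoeff g := by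
          have h0 : PowerSeries.constantCoeff (invPoch (a * q) q (d - 1)) = 1 := by
            have := congrArg PowerSeries.constantCoeff
              (poch_mul_invPoch (x := a * q) q (by simp) (d - 1))
            simpa [poch, a, map_prod] using this
          have h1 : PowerSeries.constantCoeff (shift d g) = PowerSeries.constantCoeff g := by
            rw [← PowerSeries.coeff_zero_eq_constantCoeff_apply, coeff_shift]
            simp
          have h2 : PowerSeries.constantCoeff q = PowerSeries.X := by simp [q]
          rw [e1]
          conv_lhs => rw [a, PowerSeries.coeff_X_pow_mul', if_pos le_rfl, Nat.sub_self,
            PowerSeries.coeff_zero_eq_constantCoeff_apply, ← a]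
          rw [map_mul, map_mul, h0, h1, map_pow, h2, one_mul]
        have c2 : PowerSeries.coeff j (D k) = PowerSeries.constantCoeff g := by
          rw [hg, a, PowerSeries.coeff_X_pow_mul', if_pos le_rfl]
          simp
        have c3 : PowerSeries.coeff j (D k) = PowerSeries.coeff j (D 1) := by
          have := PowerSeries.X_pow_dvd_iff.1 (all k hk le_rfl) j (Nat.lt_succ_self j)
          rwa [map_sub, sub_eq_zero] at this
        have c4 : (1 - (PowerSeries.X : PowerSeries ℤ) ^ (d * j)) *
            PowerSeries.constantCoeff g = 0 := by
          rw [sub_mul, one_mul, ← c1, ← c3, c2, sub_self]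
        have hne : (1 - (PowerSeries.X : PowerSeries ℤ) ^ (d * j)) ≠ 0 := by
          intro h
          have := congrArg PowerSeries.constantCoeff h
          have hdj : d * j ≠ 0 := by positivity
          simp [hdj] at this
        rw [c1, (mul_eq_zero.1 c4).resolve_left hne, mul_zero]
      intro i h1 h2
      simpa using dvd_add (all i h1 h2) one
  have : D i = 0 := by
    ext m : 1
    simpa using PowerSeries.X_pow_dvd_iff.1 (key (m + 1) i hi hik) m (Nat.lt_succ_self m)
  exact sub_eq_zero.1 this

/-! ### The generating functions of the partitions -/

/-- The multisets of positive integers with property `P` that have `m` members and sum `n`: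
the partitions of `n` into `m` parts with property `P`. -/
def partsSet (P : Multiset ℕ → Prop) (m n : ℕ) : Set (Multiset ℕ) :=
  {s | 0 ∉ s ∧ P s ∧ Multiset.card s = m ∧ s.sum = n}

/-- The generating function of the partitions with property `P`, where `a` counts parts. -/
noncomputable def gf (P : Multiset ℕ → Prop) : DSeries :=
  PowerSeries.mk fun m => PowerSeries.mk fun n => ((partsSet P m n).ncard : ℤ)

lemma partsSet_eq_image (P : Multiset ℕ → Prop) (m n : ℕ) :
    partsSet P m n =
      Nat.Partition.parts '' {p : n.Partition | P p.parts ∧ Multiset.card p.parts = m} := by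
  ext s
  constructor
  · rintro ⟨h0, hP, hm, hn⟩
    exact ⟨⟨s, fun {i} hi => Nat.pos_of_ne_zero fun h => h0 (h ▸ hi), hn⟩, ⟨hP, hm⟩, rfl⟩
  · rintro ⟨p, ⟨hP, hm⟩, rfl⟩
    exact ⟨fun h => (p.parts_pos h).ne' rfl, hP, hm, p.parts_sum⟩

lemma partsSet_finite (P : Multiset ℕ → Prop) (m n : ℕ) : (partsSet P m n).Finite := by
  rw [partsSet_eq_image]
  exact (Set.toFinite _).image _

lemma B_eq_gf (d k i : ℕ) :
    B d k i = gf fun s => s.count d ≤ i - 1 ∧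
      ∀ j : ℕ, 1 ≤ j → s.count (d * j) + s.count (d * j + d) ≤ k - 1 := by
  classical
  unfold B gf
  congr 1
  funext m
  congr 1
  funext n
  rw [partsSet_eq_image, Set.ncard_image_of_injective _ fun p p' h => Nat.Partition.ext h, b,
    ← Set.ncard_coe_finset]
  congr 2
  ext p
  rw [Finset.mem_coe, Finset.mem_filter]
  exact and_iff_right (Finset.mem_univ p)

lemma gf_congr {P P' : Multiset ℕ → Prop} (h : ∀ s, 0 ∉ s → (P s ↔ P' s)) : gf P = gf P' := by
  unfold gf
  congr 1
  funext m
  congr 1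
  funext n
  congr 2
  ext s
  constructor
  · rintro ⟨h0, hP, hm⟩
    exact ⟨h0, (h s h0).1 hP, hm⟩
  · rintro ⟨h0, hP, hm⟩
    exact ⟨h0, (h s h0).2 hP, hm⟩

lemma gf_or {P P' : Multiset ℕ → Prop} (h : ∀ s, P s → ¬ P' s) :
    gf (fun s => P s ∨ P' s) = gf P + gf P' := by
  ext m n
  have : partsSet (fun s => P s ∨ P' s) m n = partsSet P m n ∪ partsSet P' m n := by
    ext s
    simp only [partsSet, Set.mem_ofPred_eq, Set.mem_union]
    tauto
  simp only [gf, map_add, PowerSeries.coeff_mk]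
  rw [this, Set.ncard_union_eq ?_ (partsSet_finite _ _ _) (partsSet_finite _ _ _)]
  · push_cast; rfl
  · rw [Set.disjoint_left]
    rintro s ⟨_, hP, _⟩ ⟨_, hP', _⟩
    exact h s hP hP'

/-- Delete the parts equal to `1` and subtract `1` from the others. -/
def tail (s : Multiset ℕ) : Multiset ℕ := (s.filter (1 < ·)).map Nat.pred

/-- Add `1` to all parts and adjoin `c` parts equal to `1`. -/
def untail (c : ℕ) (s : Multiset ℕ) : Multiset ℕ := Multiset.replicate c 1 + s.map Nat.succ

lemma zero_notMem_tail (s : Multiset ℕ) : 0 ∉ tail s := by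
  simp only [tail, Multiset.mem_map, Multiset.mem_filter, not_exists, not_and, and_imp]
  intro x _ hx h
  simp only [Nat.pred_eq_sub_one] at h
  omega

lemma tail_untail (c : ℕ) {s : Multiset ℕ} (h0 : 0 ∉ s) : tail (untail c s) = s := by
  have h1 : (Multiset.replicate c 1).filter (1 < ·) = 0 := by
    rw [Multiset.filter_eq_nil]
    intro x hx
    simp [Multiset.eq_of_mem_replicate hx]
  have h2 : (s.map Nat.succ).filter (1 < ·) = s.map Nat.succ := by
    rw [Multiset.filter_eq_self]
    intro x hx
    obtain ⟨y, hy, rfl⟩ := Multiset.mem_map.1 hx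
    have : y ≠ 0 := fun h => h0 (h ▸ hy)
    omega
  rw [tail, untail, Multiset.filter_add, h1, h2, zero_add, Multiset.map_map]
  simp

lemma count_one_untail (c : ℕ) {s : Multiset ℕ} (h0 : 0 ∉ s) : (untail c s).count 1 = c := by
  have : (s.map Nat.succ).count 1 = 0 := by
    rw [Multiset.count_eq_zero]
    intro h
    obtain ⟨y, hy, h⟩ := Multiset.mem_map.1 h
    have : y = 0 := by omega
    exact h0 (this ▸ hy)
  simp [untail, this]

lemma count_tail (s : Multiset ℕ) {v : ℕ} (hv : 1 ≤ v) : (tail s).count v = s.count (v + 1) := by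
  rw [tail, Multiset.count_map, Multiset.filter_filter, ← Multiset.count_filter_of_pos
    (p := fun b => v = Nat.pred b ∧ 1 < b) (by simp; omega), Multiset.count_eq_card.2]
  intro x hx
  have := (Multiset.mem_filter.1 hx).2
  simp only [Nat.pred_eq_sub_one] at this
  omega

lemma untail_tail {s : Multiset ℕ} (h0 : 0 ∉ s) : untail (s.count 1) (tail s) = s := by
  ext v
  rcases v with _ | _ | v
  · rw [Multiset.count_eq_zero_of_notMem h0, Multiset.count_eq_zero]
    simp only [untail, Multiset.mem_add, Multiset.mem_map, not_or, not_exists]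
    exact ⟨fun h => by simpa using Multiset.eq_of_mem_replicate h, fun x hx => by simp at hx⟩
  · rw [zero_add, count_one_untail _ (zero_notMem_tail s)]
  · rw [← count_tail (untail _ _) (Nat.le_add_left 1 v), ← count_tail s (Nat.le_add_left 1 v),
      tail_untail _ (zero_notMem_tail s)]

lemma card_untail (c : ℕ) (s : Multiset ℕ) :
    Multiset.card (untail c s) = c + Multiset.card s := by
  simp [untail]

lemma sum_untail (c : ℕ) (s : Multiset ℕ) :
    (untail c s).sum = c + s.sum + Multiset.card s := by
  have : (s.map Nat.succ).sum = s.sum + Multiset.card s := by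
    induction s using Multiset.induction with
    | empty => simp
    | cons x s ih => simp only [Multiset.map_cons, Multiset.sum_cons, ih, Multiset.card_cons]; omega
  simp [untail, this, add_assoc]

lemma zero_notMem_untail (c : ℕ) (s : Multiset ℕ) : 0 ∉ untail c s := by
  simp only [untail, Multiset.mem_add, Multiset.mem_map, not_or, not_exists]
  exact ⟨fun h => by simpa using Multiset.eq_of_mem_replicate h, fun x hx => by simp at hx⟩

lemma coeff_coeff_a_pow_mul_q_pow_mul (m n c e : ℕ) (f : DSeries) :
    PowerSeries.coeff n (PowerSeries.coeff m (a ^ c * (q ^ e * f))) =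
      if c ≤ m ∧ e ≤ n then PowerSeries.coeff (n - e) (PowerSeries.coeff (m - c) f) else 0 := by
  rw [a, PowerSeries.coeff_X_pow_mul', q, ← map_pow, PowerSeries.coeff_C_mul]
  by_cases h1 : c ≤ m
  · rw [if_pos h1, PowerSeries.coeff_X_pow_mul']
    simp [h1]
  · simp [h1]

/-- Fixing the number `c` of parts equal to `1` and prescribing the partition that remains after
`1` is subtracted from the other parts. -/
lemma gf_count_one (c : ℕ) (P : Multiset ℕ → Prop) :
    gf (fun s => s.count 1 = c ∧ P (tail s)) = a ^ c * (q ^ c * shift 1 (gf P)) := by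
  ext m n
  rw [coeff_coeff_a_pow_mul_q_pow_mul, coeff_shift, PowerSeries.coeff_X_pow_mul', one_mul]
  simp only [gf, PowerSeries.coeff_mk]
  have hset : ∀ t, t ∈ partsSet (fun s => s.count 1 = c ∧ P (tail s)) m n ↔
      ∃ s, (0 ∉ s ∧ P s ∧ c + Multiset.card s = m ∧ c + s.sum + Multiset.card s = n) ∧
        untail c s = t := by
    intro t
    constructor
    · rintro ⟨h0, ⟨hc, hP⟩, hm, hn⟩
      have e := untail_tail h0
      rw [hc] at e
      refine ⟨tail t, ⟨zero_notMem_tail t, hP, ?_, ?_⟩, e⟩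
      · rw [← card_untail, e, hm]
      · rw [← sum_untail, e, hn]
    · rintro ⟨s, ⟨h0, hP, hm, hn⟩, rfl⟩
      exact ⟨zero_notMem_untail c s, ⟨count_one_untail c h0, by rwa [tail_untail c h0]⟩,
        by rw [card_untail, hm], by rw [sum_untail, hn]⟩
  by_cases hmn : c ≤ m ∧ m ≤ n
  · rw [if_pos (by omega), if_pos (by omega)]
    have : partsSet (fun s => s.count 1 = c ∧ P (tail s)) m n =
        untail c '' partsSet P (m - c) (n - c - (m - c)) := by
      ext t
      rw [hset]
      constructor
      · rintro ⟨s, ⟨h0, hP, hm, hn⟩, rfl⟩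
        exact ⟨s, ⟨h0, hP, by omega, by omega⟩, rfl⟩
      · rintro ⟨s, ⟨h0, hP, hm, hn⟩, rfl⟩
        exact ⟨s, ⟨h0, hP, by omega, by omega⟩, rfl⟩
    rw [this, Set.InjOn.ncard_image]
    intro s hs t ht h
    rw [← tail_untail c hs.1, h, tail_untail c ht.1]
  · have : partsSet (fun s => s.count 1 = c ∧ P (tail s)) m n = ∅ := by
      rw [Set.eq_empty_iff_forall_notMem]
      intro t ht
      obtain ⟨s, ⟨_, _, hm, hn⟩, _⟩ := (hset t).1 ht
      omega
    rw [this, Set.ncard_empty]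
    split_ifs with h1 h2
    · omega
    · rfl
    · rfl

lemma tail_cons_one (s : Multiset ℕ) : tail (1 ::ₘ s) = tail s := by
  simp [tail]

lemma gf_one_mem (P : Multiset ℕ → Prop) :
    gf (fun s => s.count 1 ≠ 0 ∧ P (tail s)) = a ^ 1 * (q ^ 1 * gf (fun s => P (tail s))) := by
  ext m n
  rw [coeff_coeff_a_pow_mul_q_pow_mul]
  simp only [gf, PowerSeries.coeff_mk]
  have hset : ∀ t, t ∈ partsSet (fun s => s.count 1 ≠ 0 ∧ P (tail s)) m n ↔
      ∃ s, (0 ∉ s ∧ P (tail s) ∧ Multiset.card s + 1 = m ∧ 1 + s.sum = n) ∧ 1 ::ₘ s = t := by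
    intro t
    constructor
    · rintro ⟨h0, ⟨hc, hP⟩, hm, hn⟩
      obtain ⟨s, rfl⟩ := Multiset.exists_cons_of_mem (Multiset.count_ne_zero.1 hc)
      rw [tail_cons_one] at hP
      exact ⟨s, ⟨fun h => h0 (Multiset.mem_cons_of_mem h), hP, by simpa using hm,
        by simpa using hn⟩, rfl⟩
    · rintro ⟨s, ⟨h0, hP, hm, hn⟩, rfl⟩
      exact ⟨by simpa using h0, ⟨by simp, by rwa [tail_cons_one]⟩, by simpa using hm,
        by simpa using hn⟩
  split_ifs with h
  · have : partsSet (fun s => s.count 1 ≠ 0 ∧ P (tail s)) m n =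
        Multiset.cons 1 '' partsSet (fun s => P (tail s)) (m - 1) (n - 1) := by
      ext t
      rw [hset]
      constructor
      · rintro ⟨s, ⟨h0, hP, hm, hn⟩, rfl⟩
        exact ⟨s, ⟨h0, hP, by omega, by omega⟩, rfl⟩
      · rintro ⟨s, ⟨h0, hP, hm, hn⟩, rfl⟩
        exact ⟨s, ⟨h0, hP, by omega, by omega⟩, rfl⟩
    rw [this, Set.ncard_image_of_injective _ fun s t h => (Multiset.cons_inj_right 1).1 h]
  · have : partsSet (fun s => s.count 1 ≠ 0 ∧ P (tail s)) m n = ∅ := by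
      rw [Set.eq_empty_iff_forall_notMem]
      intro t ht
      obtain ⟨s, ⟨_, _, hm, hn⟩, _⟩ := (hset t).1 ht
      omega
    rw [this, Set.ncard_empty]
    rfl

/-- Parts equal to `1` without restriction contribute the factor `1 / (1 - a q)`. -/
lemma gf_tail (P : Multiset ℕ → Prop) :
    (1 - a * q) * gf (fun s => P (tail s)) = shift 1 (gf P) := by
  have h : gf (fun s => P (tail s)) =
      gf (fun s => s.count 1 = 0 ∧ P (tail s)) + gf (fun s => s.count 1 ≠ 0 ∧ P (tail s)) := by
    rw [← gf_or fun s h h' => h'.1 h.1]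
    exact gf_congr fun s _ => by tauto
  rw [gf_count_one, gf_one_mem] at h
  linear_combination h

lemma gf_tail_iterate (P : Multiset ℕ → Prop) (j : ℕ) :
    poch (a * q) q j * gf (fun s => P (tail^[j] s)) = shift j (gf P) := by
  induction j with
  | zero => simp
  | succ j ih =>
    have h := gf_tail fun s => P (tail^[j] s)
    have e : shift 1 (poch (a * q) q j) = poch (a * q * q) q j := by simp [shift_poch]
    rw [add_comm j 1, ← shift_shift, ← ih, shift_mul, ← h, add_comm 1 j, poch_succ', e]
    simp only [Function.iterate_succ, Function.comp_apply]
    ring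

lemma count_tail_iterate (s : Multiset ℕ) {v : ℕ} (hv : 1 ≤ v) (j : ℕ) :
    (tail^[j] s).count v = s.count (v + j) := by
  induction j generalizing v with
  | zero => simp
  | succ j ih =>
    rw [Function.iterate_succ_apply', count_tail _ hv, ih (by omega)]
    congr 1
    omega

/-- The partitions in which `d` appears exactly `i - 1` times: removing the parts up to `d` and
subtracting `d` from the others leaves a partition of the same kind, in which `d` appears at most
`k - i` times. -/
lemma gf_count_eq {d k i : ℕ} (hd : 1 ≤ d) (hi : 1 ≤ i) (hik : i ≤ k) :
    gf (fun s => s.count d = i - 1 ∧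
      ∀ j : ℕ, 1 ≤ j → s.count (d * j) + s.count (d * j + d) ≤ k - 1) =
    a ^ (i - 1) * q ^ ((i - 1) * d) * invPoch (a * q) q (d - 1) * shift d (B d k (k - i + 1)) := by
  have h1 : gf (fun s => s.count d = i - 1 ∧
      ∀ j : ℕ, 1 ≤ j → s.count (d * j) + s.count (d * j + d) ≤ k - 1) =
      gf (fun s => (fun t => t.count 1 = i - 1 ∧ (fun u => u.count d ≤ (k - i + 1) - 1 ∧
      ∀ j : ℕ, 1 ≤ j → u.count (d * j) + u.count (d * j + d) ≤ k - 1) (tail t))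
        (tail^[d - 1] s)) := by
    refine gf_congr fun s _ => ?_
    have c1 : (tail^[d - 1] s).count 1 = s.count d := by
      rw [count_tail_iterate _ le_rfl]
      congr 1
      omega
    have c2 : ∀ v, 1 ≤ v → (tail (tail^[d - 1] s)).count v = s.count (v + d) := by
      intro v hv
      rw [count_tail _ hv, count_tail_iterate _ (by omega)]
      congr 1
      omega
    have hpos : ∀ j, 1 ≤ j → 1 ≤ d * j := fun j hj => Nat.mul_pos hd hj
    simp only [c1]
    rw [c2 d hd]
    refine and_congr_right fun hc => ⟨fun h => ⟨?_, fun j hj => ?_⟩, fun h j hj => ?_⟩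
    · have := h 1 le_rfl
      rw [mul_one] at this
      omega
    · rw [c2 _ (hpos j hj), c2 _ (by omega)]
      have := h (j + 1) (by omega)
      rwa [mul_add, mul_one] at this
    · obtain ⟨h1, h2⟩ := h
      rcases Nat.lt_or_ge 1 j with hj1 | hj1
      · obtain ⟨l, rfl⟩ : ∃ l, j = l + 1 := ⟨j - 1, by omega⟩
        have := h2 l (by omega)
        rw [c2 _ (hpos l (by omega)), c2 _ (by omega)] at this
        rwa [mul_add, mul_one]
      · obtain rfl : j = 1 := by omega
        rw [mul_one]
        omega
  have h2 := gf_tail_iterate (fun t => t.count 1 = i - 1 ∧ (fun u => u.count d ≤ (k - i + 1) - 1 ∧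
      ∀ j : ℕ, 1 ≤ j → u.count (d * j) + u.count (d * j + d) ≤ k - 1) (tail t)) (d - 1)
  rw [← h1, gf_count_one (i - 1) fun u => u.count d ≤ (k - i + 1) - 1 ∧
      ∀ j : ℕ, 1 ≤ j → u.count (d * j) + u.count (d * j + d) ≤ k - 1, ← B_eq_gf] at h2
  have h3 := poch_mul_invPoch (x := a * q) q (by simp) (d - 1)
  have e : d - 1 + 1 = d := by omega
  simp only [shift_mul, shift_pow, shift_a, shift_q, shift_shift, e] at h2
  have e2 : q ^ ((i - 1) * d) = (q ^ (d - 1)) ^ (i - 1) * q ^ (i - 1) := by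
    rw [← mul_pow, ← pow_succ, e, ← pow_mul, mul_comm]
  rw [e2]
  rw [mul_pow] at h2
  linear_combination invPoch (a * q) q (d - 1) * h2 - gf (fun s => s.count d = i - 1 ∧
      ∀ j : ℕ, 1 ≤ j → s.count (d * j) + s.count (d * j + d) ≤ k - 1) * h3

theorem qDiffSystem_B {d k : ℕ} (hd : 1 ≤ d) (hk : 1 ≤ k) : QDiffSystem d k (B d k) := by
  refine ⟨?_, fun i h2 hik => ?_⟩
  · have h := gf_count_eq hd le_rfl hk
    rw [Nat.sub_add_cancel hk] at h
    rw [B_eq_gf d k 1]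
    simpa using h
  · rw [← gf_count_eq hd (by omega) hik, B_eq_gf d k i, B_eq_gf d k (i - 1), ← gf_or]
    · refine gf_congr fun s _ => ?_
      rw [← or_and_right]
      refine and_congr_left fun _ => ?_
      omega
    · rintro s ⟨h1, _⟩ ⟨h3, _⟩
      omega

theorem initialValues_B (d k : ℕ) : InitialValues k (B d k) := by
  intro i _ _
  rw [atZero, B_eq_gf, ← PowerSeries.coeff_zero_eq_constantCoeff_apply, gf, PowerSeries.coeff_mk]
  ext n
  rw [PowerSeries.coeff_mk, PowerSeries.coeff_one]
  split_ifs with h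
  · have : partsSet (fun s => s.count d ≤ i - 1 ∧
        ∀ j : ℕ, 1 ≤ j → s.count (d * j) + s.count (d * j + d) ≤ k - 1) 0 n = {0} := by
      ext s
      simp only [partsSet, Set.mem_ofPred_eq, Set.mem_singleton_iff, Multiset.card_eq_zero]
      constructor
      · exact fun h => h.2.2.1
      · rintro rfl
        simp [h]
    rw [this]
    simp
  · have : partsSet (fun s => s.count d ≤ i - 1 ∧
        ∀ j : ℕ, 1 ≤ j → s.count (d * j) + s.count (d * j + d) ≤ k - 1) 0 n = ∅ := by
      rw [Set.eq_empty_iff_forall_notMem]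
      rintro s ⟨_, _, h1, h2⟩
      rw [Multiset.card_eq_zero] at h1
      rw [h1] at h2
      exact h h2.symm
    rw [this]
    simp

/-! ### The infinite product and the functions `Q` -/

theorem multipliable_pochInf :
    Multipliable fun j : ℕ => (1 : DSeries) - a * q * q ^ j := by
  simp_rw [sub_eq_add_neg]
  apply multipliable_one_add_of_summable_prod
  refine summable_of_q_pow_dvd (fun s : Finset ℕ => ∑ j ∈ s, (j + 1)) (fun N => ?_) fun s => ?_
  · refine (Finset.range N).powerset.finite_toSet.subset fun s hs => ?_
    simp only [Finset.coe_powerset, Set.mem_preimage, Set.mem_powerset_iff, Finset.coe_subset]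
    intro j hj
    have h1 := Finset.single_le_sum (f := fun j => j + 1) (fun _ _ => Nat.zero_le _) hj
    have h2 : ∑ j ∈ s, (j + 1) ≤ N := hs
    rw [Finset.mem_range]
    omega
  · rw [← Finset.prod_pow_eq_pow_sum]
    refine Finset.prod_dvd_prod_of_dvd _ _ fun j _ => ⟨-a, ?_⟩
    ring

lemma pochInf_eq_mul_shift_one :
    pochInf (a * q) q = (1 - a * q) * shift 1 (pochInf (a * q) q) := by
  have h : shift 1 (pochInf (a * q) q) = ∏' j : ℕ, (1 - a * q * q ^ (j + 1)) := by
    rw [pochInf, ← shiftHom_apply, multipliable_pochInf.map_tprod (shiftHom 1) (continuous_shift 1)]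
    refine tprod_congr fun j => ?_
    simp only [shiftHom_apply, shift_sub, shift_one, shift_mul, shift_a, shift_q, shift_pow]
    ring
  have hm : Multipliable fun j : ℕ => (1 : DSeries) - a * q * q ^ (j + 1) := by
    have := multipliable_pochInf.map (shiftHom 1) (continuous_shift 1)
    refine this.congr fun j => ?_
    simp only [Function.comp_apply, shiftHom_apply, shift_sub, shift_one, shift_mul, shift_a,
      shift_q, shift_pow]
    ring
  have h0 := tprod_eq_zero_mul' (f := fun j : ℕ => (1 : DSeries) - a * q * q ^ j) hm
  rw [pow_zero, mul_one] at h0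
  rw [h, ← h0, pochInf]

lemma pochInf_eq_poch_mul_shift (d : ℕ) :
    pochInf (a * q) q = poch (a * q) q d * shift d (pochInf (a * q) q) := by
  induction d with
  | zero => simp
  | succ d ih =>
    have h := congrArg (shift 1) ih
    rw [shift_mul, shift_shift, shift_poch, shift_mul, shift_a, shift_q, pow_one] at h
    conv_lhs => rw [pochInf_eq_mul_shift_one, h]
    rw [poch_succ', add_comm 1 d, mul_assoc (1 - a * q)]

lemma isUnit_pochInf : IsUnit (pochInf (a * q) q) := by
  rw [PowerSeries.isUnit_iff_constantCoeff, pochInf,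
    multipliable_pochInf.map_tprod _ (PowerSeries.WithPiTopology.continuous_constantCoeff _)]
  simp [a]

lemma constantCoeff_pochInf : PowerSeries.constantCoeff (pochInf (a * q) q) = 1 := by
  rw [pochInf,
    multipliable_pochInf.map_tprod _ (PowerSeries.WithPiTopology.continuous_constantCoeff _)]
  simp [a]

lemma inverse_pochInf_eq {d : ℕ} (hd : 1 ≤ d) :
    (1 - a * q ^ d) * Ring.inverse (pochInf (a * q) q) =
      invPoch (a * q) q (d - 1) * shift d (Ring.inverse (pochInf (a * q) q)) := by
  have h1 := Ring.mul_inverse_cancel _ isUnit_pochInf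
  have h2 := congrArg (shift d) h1
  rw [shift_mul, shift_one] at h2
  have h3 := pochInf_eq_poch_mul_shift d
  have h4 := poch_mul_invPoch (x := a * q) q (by simp) (d - 1)
  have h5 := poch_succ (a * q) q (d - 1)
  have h6 : a * q * q ^ (d - 1) = a * q ^ d := by
    rw [mul_assoc, ← pow_succ', Nat.sub_add_cancel hd]
  rw [Nat.sub_add_cancel hd, h6] at h5
  rw [h5] at h3
  set I := Ring.inverse (pochInf (a * q) q)
  set J := shift d I
  set R := invPoch (a * q) q (d - 1)
  linear_combination R * J * h1 - (1 - a * q ^ d) * I * h2 - I * (R * J) * h3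
    - (1 - a * q ^ d) * I * shift d (pochInf (a * q) q) * J * h4

lemma summable_QTerm {d k : ℕ} (hk : 1 ≤ k) (i : ℕ) : Summable (QTerm d k i) := by
  refine summable_nat_of_a_pow_dvd fun n => ?_
  have h : a ^ n ∣ a ^ (k * n) := pow_dvd_pow _ (Nat.le_mul_of_pos_left n hk)
  unfold QTerm
  exact ((((h.mul_left _).mul_right _).mul_right _).mul_right _).mul_right _

/-- The part of `QTerm` that does not depend on `i`, in terms of `p = q^d`. -/
noncomputable def QCore (d k n : ℕ) : DSeries :=
  (-1) ^ n * a ^ (k * n) * (q ^ d) ^ (k * n ^ 2 + (n + 1).choose 2) * poch (a * q ^ d) (q ^ d) n *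
    invPoch (q ^ d) (q ^ d) n

lemma QTerm_eq (d k i n : ℕ) :
    QTerm d k i n =
      QCore d k n * (q ^ d) ^ ((k - i) * n) * (1 - a ^ i * (q ^ d) ^ ((2 * n + 1) * i)) := by
  have e : ((2 * d * k + d) * n ^ 2 + (2 * (k - i) + 1) * d * n) / 2 =
      d * (k * n ^ 2 + (n + 1).choose 2 + (k - i) * n) := by
    have h : (n + 1).choose 2 * 2 = (n + 1) * n := by
      rw [Nat.choose_two_right, Nat.add_sub_cancel, Nat.div_mul_cancel]
      exact (mul_comm n (n + 1)) ▸ (Nat.even_mul_succ_self n).two_dvd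
    apply Nat.div_eq_of_eq_mul_left two_pos
    zify at h ⊢
    linear_combination (-d : ℤ) * h
  rw [QTerm, e, QCore]
  have e2 : (2 * n + 1) * d * i = d * ((2 * n + 1) * i) := by ring
  rw [e2, pow_mul, pow_mul, pow_add]
  ring

lemma QCore_succ {d : ℕ} (hd : 1 ≤ d) (k n : ℕ) :
    QCore d k (n + 1) * (1 - (q ^ d) ^ (n + 1)) =
      -QCore d k n * a ^ k * (q ^ d) ^ (k * (2 * n + 1) + n + 1) * (1 - a * (q ^ d) ^ (n + 1)) := by
  have h1 := invPoch_succ (x := q ^ d) (q ^ d) (by simp; omega) n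
  have h2 : (n + 1 + 1).choose 2 = n + 1 + (n + 1).choose 2 := by
    rw [Nat.choose_succ_succ' (n + 1) 1, Nat.choose_one_right]
  rw [QCore, QCore, poch_succ, h2, ← h1]
  ring

lemma one_sub_mul_shift_QCore {d : ℕ} (hd : 1 ≤ d) (k n : ℕ) :
    (1 - a * q ^ d) * shift d (QCore d k n) =
      QCore d k n * (q ^ d) ^ (k * n) * (1 - a * (q ^ d) ^ (n + 1)) := by
  have h1 := poch_succ' (a * q ^ d) (q ^ d) n
  rw [poch_succ] at h1
  have h2 : shift d (QCore d k n) = (-1) ^ n * (a * q ^ d) ^ (k * n) *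
      (q ^ d) ^ (k * n ^ 2 + (n + 1).choose 2) * poch (a * q ^ d * q ^ d) (q ^ d) n *
      shift d (invPoch (q ^ d) (q ^ d) n) := by
    simp [QCore, shift_poch]
  rw [h2, QCore, shift_invPoch _ _ (by simp; omega), shift_pow, shift_q]
  generalize q ^ d = p at *
  linear_combination (-1) ^ n * (a * p) ^ (k * n) * p ^ (k * n ^ 2 + (n + 1).choose 2) *
    invPoch p p n * (-h1)

/-- The telescoping form of the second equation of the system for the series in `Q`. -/
lemma QTerm_sub_sub (d j l n : ℕ) (hd : 1 ≤ d) :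
    QTerm d (j + 1 + l) (j + 1) n - QTerm d (j + 1 + l) j n -
        a ^ j * (q ^ d) ^ j * (1 - a * q ^ d) * shift d (QTerm d (j + 1 + l) (l + 1) n) =
      QCore d (j + 1 + l) n * (q ^ d) ^ (l * n) * (1 - (q ^ d) ^ n) -
        QCore d (j + 1 + l) (n + 1) * (q ^ d) ^ (l * (n + 1)) * (1 - (q ^ d) ^ (n + 1)) := by
  have h1 := QCore_succ hd (j + 1 + l) n
  have h2 := one_sub_mul_shift_QCore hd (j + 1 + l) n
  have e1 : j + 1 + l - (j + 1) = l := by omega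
  have e2 : j + 1 + l - j = l + 1 := by omega
  have e3 : j + 1 + l - (l + 1) = j := by omega
  rw [QTerm_eq, QTerm_eq, QTerm_eq, e1, e2, e3]
  simp only [shift_mul, shift_sub, shift_one, shift_pow, shift_a, shift_q]
  generalize q ^ d = p at *
  linear_combination (p ^ (l * (n + 1))) * h1 - a ^ j * p ^ j * p ^ (j * n) *
    (1 - (a * p) ^ (l + 1) * p ^ ((2 * n + 1) * (l + 1))) * h2

lemma tsum_QTerm_sub {d k i : ℕ} (hd : 1 ≤ d) (hi : 1 ≤ i) (hik : i ≤ k) :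
    ∑' n, QTerm d k i n = ∑' n, QTerm d k (i - 1) n +
      a ^ (i - 1) * q ^ ((i - 1) * d) * (1 - a * q ^ d) *
        shift d (∑' n, QTerm d k (k - i + 1) n) := by
  obtain ⟨j, rfl⟩ : ∃ j, i = j + 1 := ⟨i - 1, by omega⟩
  obtain ⟨l, rfl⟩ : ∃ l, k = j + 1 + l := ⟨k - (j + 1), by omega⟩
  have e1 : j + 1 + l - (j + 1) + 1 = l + 1 := by omega
  rw [e1, Nat.add_sub_cancel, mul_comm j d, pow_mul]
  have hs := fun i => (summable_QTerm (d := d) (k := j + 1 + l) (by omega) i).hasSum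
  have h1 := ((hs (j + 1)).sub (hs j)).sub
    ((hasSum_shift (hs (l + 1)) d).mul_left (a ^ j * (q ^ d) ^ j * (1 - a * q ^ d)))
  have h2 : HasSum (fun n => QCore d (j + 1 + l) n * (q ^ d) ^ (l * n) * (1 - (q ^ d) ^ n) -
        QCore d (j + 1 + l) (n + 1) * (q ^ d) ^ (l * (n + 1)) * (1 - (q ^ d) ^ (n + 1))) 0 := by
    refine hasSum_sub_succ (U := fun n => QCore d (j + 1 + l) n * (q ^ d) ^ (l * n) *
      (1 - (q ^ d) ^ n)) (summable_nat_of_a_pow_dvd fun n => ?_) (by simp)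
    have h : a ^ n ∣ a ^ ((j + 1 + l) * n) := pow_dvd_pow _ (Nat.le_mul_of_pos_left n (by omega))
    unfold QCore
    exact (((((h.mul_left _).mul_right _).mul_right _).mul_right _).mul_right _).mul_right _
  simp_rw [QTerm_sub_sub d j l _ hd] at h1
  linear_combination h1.unique h2

lemma tsum_QTerm_zero (d k : ℕ) : ∑' n, QTerm d k 0 n = 0 := by
  simp [QTerm]

theorem qDiffSystem_Q {d k : ℕ} (hd : 1 ≤ d) (hk : 1 ≤ k) : QDiffSystem d k (Q d k) := by
  have hI := inverse_pochInf_eq hd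
  have key : ∀ i, 1 ≤ i → i ≤ k → Q d k i =
      Ring.inverse (pochInf (a * q) q) * ∑' n, QTerm d k (i - 1) n +
        a ^ (i - 1) * q ^ ((i - 1) * d) * invPoch (a * q) q (d - 1) *
          shift d (Q d k (k - i + 1)) := by
    intro i h1 h2
    rw [Q, tsum_QTerm_sub hd h1 h2, Q, shift_mul]
    linear_combination a ^ (i - 1) * q ^ ((i - 1) * d) *
      shift d (∑' n, QTerm d k (k - i + 1) n) * hI
  refine ⟨?_, fun i h2 hik => key i (by omega) hik⟩
  rw [key 1 le_rfl hk, Nat.sub_self, tsum_QTerm_zero, Nat.sub_add_cancel hk]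
  ring

theorem initialValues_Q (d k : ℕ) : InitialValues k (Q d k) := by
  intro i hi hik
  have h1 : PowerSeries.constantCoeff (∑' n, QTerm d k i n) = 1 := by
    rw [(summable_QTerm (by omega) i).map_tsum _
      (PowerSeries.WithPiTopology.continuous_constantCoeff _), tsum_eq_single 0]
    · simp [QTerm, a]
      omega
    · intro n hn
      have : k * n ≠ 0 := Nat.mul_ne_zero (by omega) hn
      simp [QTerm, a, this]
  have h2 := congrArg PowerSeries.constantCoeff (Ring.mul_inverse_cancel _ isUnit_pochInf)
  rw [map_mul, constantCoeff_pochInf, one_mul, map_one] at h2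
  rw [atZero, Q, map_mul, h1, h2, one_mul]

/-! ### The cases in which `F` is a single sum -/

lemma hasSum_of_eq {ι : Type*} {R : Type*} [AddCommMonoid R] [TopologicalSpace R]
    {f g : ι → R} {s : R} (h : HasSum f s)
    (e : ∀ i, g i = f i) : HasSum g s := by
  rwa [funext e]

lemma hasSum_tsum_of_a_pow_dvd {f : ℕ → DSeries} (h : ∀ n, a ^ n ∣ f n) : HasSum f (∑' n, f n) :=
  (summable_nat_of_a_pow_dvd h).hasSum

lemma atZero_invPoch {x : DSeries} (y : DSeries) (hx : atZero x = 0) (n : ℕ) :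
    atZero (invPoch x y n) = 1 := by
  have h : coeffZero x = 0 := by
    have : coeffZero x = PowerSeries.constantCoeff (atZero x) := rfl
    rw [this, hx, map_zero]
  have h1 := congrArg PowerSeries.constantCoeff (poch_mul_invPoch y h n)
  rw [atZero] at hx ⊢
  simpa [poch, map_prod, hx] using h1

@[simp] lemma atZero_a : atZero a = 0 := by simp [atZero, a]

@[simp] lemma atZero_mul (f g : DSeries) : atZero (f * g) = atZero f * atZero g :=
  map_mul PowerSeries.constantCoeff f g

lemma atZero_add (f g : DSeries) : atZero (f + g) = atZero f + atZero g :=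
  map_add PowerSeries.constantCoeff f g

@[simp] lemma atZero_one : atZero 1 = 1 := map_one PowerSeries.constantCoeff

lemma atZero_poch {x : DSeries} (y : DSeries) (hx : atZero x = 0) (n : ℕ) :
    atZero (poch x y n) = 1 := by
  rw [atZero] at hx ⊢
  simp [poch, map_prod, hx]

lemma atZero_of_hasSum {f : ℕ → DSeries} {s : DSeries} (h : HasSum f s) (hf : ∀ n, a ^ n ∣ f n) :
    atZero s = atZero (f 0) := by
  have h1 := h.map (PowerSeries.constantCoeff (R := PowerSeries ℤ))
    (PowerSeries.WithPiTopology.continuous_constantCoeff _)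
  refine h1.unique (hasSum_of_eq (hasSum_ite_eq 0 (atZero (f 0))) fun n => ?_)
  rcases Nat.eq_zero_or_pos n with rfl | hn
  · simp [atZero]
  · obtain ⟨g, hg⟩ := hf n
    simp [hg, a, hn.ne']

lemma two_mul_choose_two_add (n : ℕ) : 2 * n.choose 2 + n = n ^ 2 := by
  induction n with
  | zero => rfl
  | succ n ih =>
    rw [Nat.choose_succ_succ' n 1, Nat.choose_one_right]
    linear_combination ih

/-- The factor `1 / (aq; q)_1` of the system for `d = 2`, absorbed by a shift. -/
lemma mul_shift_invPoch_two (n : ℕ) :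
    invPoch (a * q) q 1 * shift 2 (invPoch (a * q) (q ^ 2) n) =
      invPoch (a * q) (q ^ 2) (n + 1) := by
  have h1 := invPoch_succ' (x := a * q) (q ^ 2) (by simp) n
  have h2 := poch_mul_invPoch (x := a * q) q (by simp) 1
  have e : a * q ^ 2 * q = a * q * q ^ 2 := by ring
  rw [shift_invPoch _ _ (by simp), shift_mul, shift_a, shift_pow, shift_q, e, ← h1]
  simp only [poch, Finset.prod_range_one, pow_zero, mul_one] at h2
  linear_combination invPoch (a * q) (q ^ 2) (n + 1) * h2

/-- The factor `1 / (aq; q)_2` of the system for `d = 3`, absorbed by a shift. -/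
lemma mul_shift_poch_mul_invPoch_three (n j : ℕ) :
    invPoch (a * q) q 2 * (shift 3 (poch a (q ^ 3) n) * shift 3 (invPoch a q j)) =
      poch a (q ^ 3) (n + 1) * invPoch a q (j + 3) := by
  have h1 := invPoch_add (x := a) q (by simp) 3 j
  have h2 := invPoch_succ' (x := a) q (by simp) 2
  rw [shift_invPoch _ _ (by simp), shift_poch, shift_a, shift_pow, shift_q, add_comm j 3, h1,
    poch_succ', ← h2]
  ring

lemma poch_mul_invPoch_eq (n j : ℕ) :
    poch (a * q ^ 3) (q ^ 3) n * invPoch (a * q) q j =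
      poch a (q ^ 3) (n + 1) * invPoch a q (j + 1) := by
  rw [poch_succ', ← invPoch_succ' (x := a) q (by simp)]
  ring

lemma shift_invPoch_q (d e n : ℕ) (he : 1 ≤ e) :
    shift d (invPoch (q ^ e) (q ^ e) n) = invPoch (q ^ e) (q ^ e) n := by
  rw [shift_invPoch _ _ (by simp; omega), shift_pow, shift_q]

lemma shift_invPoch_q_q (d n : ℕ) : shift d (invPoch q q n) = invPoch q q n := by
  simpa using shift_invPoch_q d 1 n le_rfl

/-- A series whose terms telescope with vanishing initial value has the sum zero. -/
lemma eq_zero_of_telescoping {E : ℕ → DSeries} {s : DSeries} (h : HasSum E s) (U : ℕ → DSeries)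
    (hU : ∀ n, a ^ n ∣ U n) (h0 : U 0 = 0) (hE : ∀ n, E n = U n - U (n + 1)) : s = 0 :=
  h.unique (hasSum_of_eq (hasSum_sub_succ (summable_nat_of_a_pow_dvd hU) h0) hE)

/-! ### The case `(d, k) = (2, 2)` -/

lemma hasSum_F221 : HasSum (fun n => a ^ n * (q ^ (3 * n.choose 2 + 3 * n) *
    invPoch (a * q) (q ^ 2) (n + 1) * invPoch q q n)) F221 := by
  have h : F221 = ∑' n, a ^ n * (q ^ (3 * n.choose 2 + 3 * n) *
      invPoch (a * q) (q ^ 2) (n + 1) * invPoch q q n) := by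
    refine tsum_congr fun n => ?_
    have e : (3 * n ^ 2 + 3 * n) / 2 = 3 * n.choose 2 + 3 * n := by
      apply Nat.div_eq_of_eq_mul_left two_pos
      have := two_mul_choose_two_add n
      omega
    rw [e]
    ring
  rw [h]
  exact hasSum_tsum_of_a_pow_dvd fun n => dvd_mul_right _ _

lemma hasSum_F222 : HasSum (fun n => a ^ n * (q ^ (3 * n.choose 2 + n) *
    invPoch (a * q) (q ^ 2) n * invPoch q q n)) F222 := by
  have h : F222 = ∑' n, a ^ n * (q ^ (3 * n.choose 2 + n) *
      invPoch (a * q) (q ^ 2) n * invPoch q q n) := by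
    refine tsum_congr fun n => ?_
    have e : (3 * n ^ 2 - n) / 2 = 3 * n.choose 2 + n := by
      have := two_mul_choose_two_add n
      omega
    rw [e]
    ring
  rw [h]
  exact hasSum_tsum_of_a_pow_dvd fun n => dvd_mul_right _ _

lemma F221_eq : F221 = invPoch (a * q) q 1 * shift 2 F222 := by
  refine hasSum_F221.unique
    (hasSum_of_eq ((hasSum_shift hasSum_F222 2).mul_left _) fun n => ?_)
  simp only [shift_mul, shift_pow, shift_a, shift_q, shift_invPoch_q_q]
  linear_combination -(a * q ^ 2) ^ n * q ^ (3 * n.choose 2 + n) * invPoch q q n *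
    mul_shift_invPoch_two n

lemma F222_eq : F222 = F221 + a * q ^ 2 * invPoch (a * q) q 1 * shift 2 F221 := by
  have h := eq_zero_of_telescoping ((hasSum_F222.sub hasSum_F221).sub
      ((hasSum_shift hasSum_F221 2).mul_left (a * q ^ 2 * invPoch (a * q) q 1)))
    (fun n => a ^ n * ((1 - q ^ n) * (1 + q ^ n - a * q ^ (2 * n + 1)) * q ^ (3 * n.choose 2 + n) *
      invPoch (a * q) (q ^ 2) (n + 1) * invPoch q q n))
    (fun n => dvd_mul_right _ _) (by simp) fun n => ?_
  · linear_combination h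
  · have e1 := mul_shift_invPoch_two (n + 1)
    have e2 := invPoch_succ (x := a * q) (q ^ 2) (by simp) n
    have e3 := invPoch_succ (x := a * q) (q ^ 2) (by simp) (n + 1)
    have e4 := invPoch_succ (x := q) q (by simp) n
    simp only [shift_mul, shift_pow, shift_a, shift_q, shift_invPoch_q_q]
    generalize shift 2 (invPoch (a * q) (q ^ 2) (n + 1)) = S at e1 ⊢
    rw [Nat.choose_succ_succ' n 1, Nat.choose_one_right, ← e2, ← e3, ← e4]
    linear_combination -a * q ^ 2 * (a * q ^ 2) ^ n * q ^ (3 * n.choose 2 + 3 * n) *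
      ((1 - q * q ^ n) * invPoch q q (n + 1)) * e1

/-! ### The case `(d, k) = (2, 3)` -/

lemma hasSum_F231 : HasSum (fun n => a ^ n * (q ^ (n ^ 2 + 2 * n) *
    invPoch (a * q) (q ^ 2) (n + 1) * invPoch q q n)) F231 := by
  simp_rw [F231, mul_assoc]
  exact hasSum_tsum_of_a_pow_dvd fun n => dvd_mul_right _ _

lemma hasSum_F232 : HasSum (fun n => a ^ n * (q ^ (n ^ 2 + n) *
    invPoch (a * q) (q ^ 2) (n + 1) * invPoch q q n)) F232 := by
  simp_rw [F232, mul_assoc]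
  exact hasSum_tsum_of_a_pow_dvd fun n => dvd_mul_right _ _

lemma hasSum_F233 : HasSum (fun n => a ^ n * (q ^ (n ^ 2) *
    invPoch (a * q) (q ^ 2) n * invPoch q q n)) F233 := by
  simp_rw [F233, mul_assoc]
  exact hasSum_tsum_of_a_pow_dvd fun n => dvd_mul_right _ _

lemma F231_eq : F231 = invPoch (a * q) q 1 * shift 2 F233 := by
  refine hasSum_F231.unique
    (hasSum_of_eq ((hasSum_shift hasSum_F233 2).mul_left _) fun n => ?_)
  simp only [shift_mul, shift_pow, shift_a, shift_q, shift_invPoch_q_q]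
  linear_combination -(a * q ^ 2) ^ n * q ^ (n ^ 2) * invPoch q q n * mul_shift_invPoch_two n

lemma F232_eq : F232 = F231 + a * q ^ 2 * invPoch (a * q) q 1 * shift 2 F232 := by
  have h := eq_zero_of_telescoping ((hasSum_F232.sub hasSum_F231).sub
      ((hasSum_shift hasSum_F232 2).mul_left (a * q ^ 2 * invPoch (a * q) q 1)))
    (fun n => a ^ n * ((1 - q ^ n) * q ^ (n ^ 2 + n) *
      invPoch (a * q) (q ^ 2) (n + 1) * invPoch q q n))
    (fun n => dvd_mul_right _ _) (by simp) fun n => ?_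
  · linear_combination h
  · have e1 := mul_shift_invPoch_two (n + 1)
    have e4 := invPoch_succ (x := q) q (by simp) n
    simp only [shift_mul, shift_pow, shift_a, shift_q, shift_invPoch_q_q]
    rw [← e4]
    linear_combination -a * q ^ 2 * (a * q ^ 2) ^ n * q ^ (n ^ 2 + n) *
      ((1 - q * q ^ n) * invPoch q q (n + 1)) * e1

lemma F233_eq : F233 = F232 + a ^ 2 * q ^ 4 * invPoch (a * q) q 1 * shift 2 F231 := by
  have h := eq_zero_of_telescoping ((hasSum_F233.sub hasSum_F232).sub
      ((hasSum_shift hasSum_F231 2).mul_left (a ^ 2 * q ^ 4 * invPoch (a * q) q 1)))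
    (fun n => a ^ n * ((1 - q ^ n) * q ^ (n ^ 2) *
      invPoch (a * q) (q ^ 2) (n + 1) * invPoch q q n))
    (fun n => dvd_mul_right _ _) (by simp) fun n => ?_
  · linear_combination h
  · have e1 := mul_shift_invPoch_two (n + 1)
    have e2 := invPoch_succ (x := a * q) (q ^ 2) (by simp) n
    have e3 := invPoch_succ (x := a * q) (q ^ 2) (by simp) (n + 1)
    have e4 := invPoch_succ (x := q) q (by simp) n
    simp only [shift_mul, shift_pow, shift_a, shift_q, shift_invPoch_q_q]
    generalize shift 2 (invPoch (a * q) (q ^ 2) (n + 1)) = S at e1 ⊢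
    rw [← e2, ← e3, ← e4]
    linear_combination -a ^ 2 * q ^ 4 * (a * q ^ 2) ^ n * q ^ (n ^ 2 + 2 * n) *
      ((1 - q * q ^ n) * invPoch q q (n + 1)) * e1

/-! ### The case `(d, k) = (3, 4)` -/

lemma hasSum_F341 : HasSum (fun n => a ^ n * (q ^ (n * (n + 3)) *
    (poch a (q ^ 3) (n + 1) * invPoch a q (2 * n + 3)) * invPoch q q n)) F341 := by
  have e : ∀ n, poch a (q ^ 3) (n + 1) * invPoch a q (2 * n + 3) =
      poch (a * q ^ 3) (q ^ 3) n * invPoch (a * q) q (2 * n + 2) :=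
    fun n => (poch_mul_invPoch_eq n _).symm
  simp_rw [e, F341, mul_assoc]
  exact hasSum_tsum_of_a_pow_dvd fun n => dvd_mul_right _ _

lemma hasSum_F342 : HasSum (fun n => a ^ n * (q ^ (n * (n + 2)) *
    (poch a (q ^ 3) (n + 1) * invPoch a q (2 * n + 3)) * invPoch q q n)) F342 := by
  have e : ∀ n, poch a (q ^ 3) (n + 1) * invPoch a q (2 * n + 3) =
      poch (a * q ^ 3) (q ^ 3) n * invPoch (a * q) q (2 * n + 2) :=
    fun n => (poch_mul_invPoch_eq n _).symm
  simp_rw [e, F342, mul_assoc]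
  exact hasSum_tsum_of_a_pow_dvd fun n => dvd_mul_right _ _

lemma hasSum_F343 : HasSum (fun n => a ^ n * (q ^ (n * (n + 1)) *
    (poch a (q ^ 3) (n + 1) * invPoch a q (2 * n + 2)) * invPoch q q n)) F343 := by
  have e : ∀ n, poch a (q ^ 3) (n + 1) * invPoch a q (2 * n + 2) =
      poch (a * q ^ 3) (q ^ 3) n * invPoch (a * q) q (2 * n + 1) :=
    fun n => (poch_mul_invPoch_eq n _).symm
  simp_rw [e, F343, mul_assoc]
  exact hasSum_tsum_of_a_pow_dvd fun n => dvd_mul_right _ _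

lemma hasSum_F344 : HasSum (fun n => a ^ n * (q ^ (n ^ 2) *
    (poch a (q ^ 3) n * invPoch a q (2 * n)) * invPoch q q n)) F344 := by
  simp_rw [F344, mul_assoc]
  exact hasSum_tsum_of_a_pow_dvd fun n => dvd_mul_right _ _

lemma F341_eq : F341 = invPoch (a * q) q 2 * shift 3 F344 := by
  refine hasSum_F341.unique
    (hasSum_of_eq ((hasSum_shift hasSum_F344 3).mul_left _) fun n => ?_)
  simp only [shift_mul, shift_pow, shift_a, shift_q, shift_invPoch_q_q]
  linear_combination -(a * q ^ 3) ^ n * q ^ (n ^ 2) * invPoch q q n *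
    mul_shift_poch_mul_invPoch_three n (2 * n)

lemma F342_eq : F342 = F341 + a * q ^ 3 * invPoch (a * q) q 2 * shift 3 F343 := by
  have h := eq_zero_of_telescoping ((hasSum_F342.sub hasSum_F341).sub
      ((hasSum_shift hasSum_F343 3).mul_left (a * q ^ 3 * invPoch (a * q) q 2)))
    (fun n => a ^ n * ((1 - q ^ n) * q ^ (n ^ 2 + 2 * n) *
      (poch a (q ^ 3) (n + 1) * invPoch a q (2 * n + 3)) * invPoch q q n))
    (fun n => dvd_mul_right _ _) (by simp) fun n => ?_
  · linear_combination h
  · have e1 := mul_shift_poch_mul_invPoch_three (n + 1) (2 * n + 2)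
    have e4 := invPoch_succ (x := q) q (by simp) n
    simp only [shift_mul, shift_pow, shift_a, shift_q, shift_invPoch_q_q]
    have i1 : 2 * (n + 1) + 3 = 2 * n + 2 + 3 := by ring
    rw [← e4, i1]
    linear_combination -a * q ^ 3 * (a * q ^ 3) ^ n * q ^ (n * (n + 1)) *
      ((1 - q * q ^ n) * invPoch q q (n + 1)) * e1

/-- The polynomial of the telescoping sum is found by solving linear equations for its
coefficients. -/
lemma F343_eq : F343 = F342 + a ^ 2 * q ^ 6 * invPoch (a * q) q 2 * shift 3 F342 := by
  have h := eq_zero_of_telescoping ((hasSum_F343.sub hasSum_F342).sub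
      ((hasSum_shift hasSum_F342 3).mul_left (a ^ 2 * q ^ 6 * invPoch (a * q) q 2)))
    (fun n => a ^ n * ((1 - q ^ n) * q ^ (n ^ 2 + n) *
      (1 - a * q ^ (2 * n + 3) + a ^ 2 * q ^ (4 * n + 5)) *
      (poch a (q ^ 3) (n + 1) * invPoch a q (2 * n + 4)) * invPoch q q n))
    (fun n => dvd_mul_right _ _) (by simp) fun n => ?_
  · linear_combination h
  · have e1 := mul_shift_poch_mul_invPoch_three (n + 1) (2 * n + 3)
    have e4 := invPoch_succ (x := q) q (by simp) n
    have e5 := invPoch_succ (x := a) q (by simp) (2 * n + 2)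
    have e6 := invPoch_succ (x := a) q (by simp) (2 * n + 3)
    have e7 := invPoch_succ (x := a) q (by simp) (2 * n + 4)
    have e8 := invPoch_succ (x := a) q (by simp) (2 * n + 5)
    have i1 : 2 * (n + 1) + 4 = 2 * n + 6 := by ring
    simp only [shift_mul, shift_pow, shift_a, shift_q, shift_invPoch_q_q]
    generalize shift 3 (poch a (q ^ 3) (n + 1)) * shift 3 (invPoch a q (2 * n + 3)) = S at e1 ⊢
    rw [poch_succ] at e1
    rw [← e5, ← e6, ← e7, ← e8, ← e4, i1, poch_succ a (q ^ 3) (n + 1)]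
    linear_combination -a ^ 2 * q ^ 6 * (a * q ^ 3) ^ n * q ^ (n * (n + 2)) *
      ((1 - q * q ^ n) * invPoch q q (n + 1)) * e1

/-- The polynomial of the telescoping sum is found by solving linear equations for its
coefficients. -/
lemma F344_eq : F344 = F343 + a ^ 3 * q ^ 9 * invPoch (a * q) q 2 * shift 3 F341 := by
  have h := eq_zero_of_telescoping ((hasSum_F344.sub hasSum_F343).sub
      ((hasSum_shift hasSum_F341 3).mul_left (a ^ 3 * q ^ 9 * invPoch (a * q) q 2)))
    (fun n => a ^ n * ((1 - q ^ n) * q ^ (n ^ 2) *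
      (1 - a * (1 + q ^ 2 + q ^ 3) * q ^ (2 * n) - a * q ^ (3 * n)
        + a ^ 2 * (q + q ^ 2 + q ^ 3 + q ^ 4 + q ^ 5) * q ^ (4 * n)
        + a ^ 2 * (q ^ 2 + q ^ 3) * q ^ (5 * n)
        - a ^ 3 * (q ^ 3 + q ^ 4 + q ^ 5) * q ^ (6 * n)
        - a ^ 3 * (q ^ 4 + q ^ 5) * q ^ (7 * n) + a ^ 4 * q ^ 6 * q ^ (8 * n)) *
      (poch a (q ^ 3) n * invPoch a q (2 * n + 4)) * invPoch q q n))
    (fun n => dvd_mul_right _ _) (by simp) fun n => ?_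
  · linear_combination h
  · have e1 := mul_shift_poch_mul_invPoch_three (n + 1) (2 * n + 3)
    have e2 := invPoch_succ (x := a) q (by simp) (2 * n)
    have e3 := invPoch_succ (x := a) q (by simp) (2 * n + 1)
    have e4 := invPoch_succ (x := q) q (by simp) n
    have e5 := invPoch_succ (x := a) q (by simp) (2 * n + 2)
    have e6 := invPoch_succ (x := a) q (by simp) (2 * n + 3)
    have e7 := invPoch_succ (x := a) q (by simp) (2 * n + 4)
    have e8 := invPoch_succ (x := a) q (by simp) (2 * n + 5)
    have i1 : 2 * (n + 1) + 4 = 2 * n + 6 := by ring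
    simp only [shift_mul, shift_pow, shift_a, shift_q, shift_invPoch_q_q]
    generalize shift 3 (poch a (q ^ 3) (n + 1)) * shift 3 (invPoch a q (2 * n + 3)) = S at e1 ⊢
    rw [poch_succ, poch_succ] at e1
    rw [← e2, ← e3, ← e5, ← e6, ← e7, ← e8, ← e4, i1, poch_succ a (q ^ 3) n]
    linear_combination -a ^ 3 * q ^ 9 * (a * q ^ 3) ^ n * q ^ (n * (n + 3)) *
      ((1 - q * q ^ n) * invPoch q q (n + 1)) * e1

/-! ### The resulting instances of the system -/

lemma F22_system : QDiffSystem 2 2 (F 2 2) := by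
  refine ⟨F221_eq, fun i h2 hi => ?_⟩
  interval_cases i
  simpa [F] using F222_eq

lemma F23_system : QDiffSystem 2 3 (F 2 3) := by
  refine ⟨F231_eq, fun i h2 hi => ?_⟩
  interval_cases i
  · simpa [F] using F232_eq
  · simpa [F] using F233_eq

lemma F34_system : QDiffSystem 3 4 (F 3 4) := by
  refine ⟨F341_eq, fun i h2 hi => ?_⟩
  interval_cases i
  · simpa [F] using F342_eq
  · simpa [F] using F343_eq
  · simpa [F] using F344_eq

lemma F22_initial : InitialValues 2 (F 2 2) := by
  intro i h1 h2
  interval_cases i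
  · exact (atZero_of_hasSum hasSum_F221 fun n => dvd_mul_right _ _).trans (by simp [atZero_invPoch])
  · exact (atZero_of_hasSum hasSum_F222 fun n => dvd_mul_right _ _).trans (by simp)

lemma F23_initial : InitialValues 3 (F 2 3) := by
  intro i h1 h2
  interval_cases i
  · exact (atZero_of_hasSum hasSum_F231 fun n => dvd_mul_right _ _).trans (by simp [atZero_invPoch])
  · exact (atZero_of_hasSum hasSum_F232 fun n => dvd_mul_right _ _).trans (by simp [atZero_invPoch])
  · exact (atZero_of_hasSum hasSum_F233 fun n => dvd_mul_right _ _).trans (by simp)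

lemma F34_initial : InitialValues 4 (F 3 4) := by
  intro i h1 h2
  interval_cases i
  · exact (atZero_of_hasSum hasSum_F341 fun n => dvd_mul_right _ _).trans
      (by simp [atZero_invPoch, atZero_poch])
  · exact (atZero_of_hasSum hasSum_F342 fun n => dvd_mul_right _ _).trans
      (by simp [atZero_invPoch, atZero_poch])
  · exact (atZero_of_hasSum hasSum_F343 fun n => dvd_mul_right _ _).trans
      (by simp [atZero_invPoch, atZero_poch])
  · exact (atZero_of_hasSum hasSum_F344 fun n => dvd_mul_right _ _).trans (by simp)

/-! ### Double sums as single sums of shifted solutions -/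

/-- Summation over `n` and `0 ≤ r ≤ n / d`, rearranged with `n = m + d r` and `r` outermost. -/
lemma hasSum_of_hasSum_inner {d : ℕ} (hd : 1 ≤ d) {f : ℕ → ℕ → DSeries} {g : ℕ → DSeries}
    (hf : ∀ m r, a ^ (m + r) ∣ f (m + d * r) r)
    (hg : ∀ r, HasSum (fun m => f (m + d * r) r) (g r)) :
    HasSum g (∑' n, ∑ r ∈ Finset.range (n / d + 1), f n r) := by
  have hs : Summable fun z : ℕ × ℕ => f (z.2 + d * z.1) z.1 := by
    refine summable_of_a_pow_dvd (fun z : ℕ × ℕ => z.2 + z.1) (fun N => ?_) fun z => hf _ _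
    refine ((Set.finite_Iic N).prod (Set.finite_Iic N)).subset fun z hz => ?_
    have : z.2 + z.1 ≤ N := hz
    exact ⟨by simp only [Set.mem_Iic]; omega, by simp only [Set.mem_Iic]; omega⟩
  have h1 := hs.hasSum.prod_fiberwise hg
  set S := ∑' z : ℕ × ℕ, f (z.2 + d * z.1) z.1
  let i : ℕ × ℕ → ℕ × ℕ := fun z => (z.2 + d * z.1, z.1)
  have hi : Function.Injective i := by
    rintro ⟨r, m⟩ ⟨r', m'⟩ h
    simp only [i, Prod.mk.injEq] at h
    obtain ⟨h1, rfl⟩ := h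
    simp only [Prod.mk.injEq, true_and]
    omega
  have h2 : HasSum (fun z : ℕ × ℕ => if d * z.2 ≤ z.1 then f z.1 z.2 else 0) S := by
    rw [← hi.hasSum_iff]
    · refine hasSum_of_eq hs.hasSum fun z => ?_
      simp [i]
    · rintro ⟨n, r⟩ hz
      refine if_neg fun h => hz ⟨(r, n - d * r), ?_⟩
      simp only [i, Prod.mk.injEq, and_true] at h ⊢
      omega
  have h3 : ∀ n, HasSum (fun r => if d * r ≤ n then f n r else 0)
      (∑ r ∈ Finset.range (n / d + 1), f n r) := by
    intro n
    have hmem : ∀ r, r ∈ Finset.range (n / d + 1) ↔ d * r ≤ n := by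
      intro r
      rw [Finset.mem_range, Nat.lt_succ_iff, Nat.le_div_iff_mul_le (by omega), mul_comm]
    rw [Finset.sum_congr rfl fun r hr => (if_pos ((hmem r).1 hr)).symm]
    exact hasSum_sum_of_ne_finset_zero fun r hr => if_neg fun h => hr ((hmem r).2 h)
  rw [(h2.prod_fiberwise h3).tsum_eq]
  exact h1

/-- The product of the factors `1 / (a q^(dj+1); q)_(d-1)` for `j < n`. -/
noncomputable def prefactor (d n : ℕ) : DSeries :=
  ∏ j ∈ Finset.range n, shift (d * j) (invPoch (a * q) q (d - 1))

lemma prefactor_succ (d n : ℕ) :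
    prefactor d (n + 1) = prefactor d n * shift (d * n) (invPoch (a * q) q (d - 1)) :=
  Finset.prod_range_succ _ _

lemma mul_shift_prefactor (d n : ℕ) :
    invPoch (a * q) q (d - 1) * shift d (prefactor d n) = prefactor d (n + 1) := by
  rw [prefactor, prefactor, Finset.prod_range_succ', ← shiftHom_apply, map_prod]
  simp only [shiftHom_apply, shift_shift, mul_zero, shift_zero]
  rw [mul_comm]
  congr 1
  refine Finset.prod_congr rfl fun j _ => ?_
  congr 1
  ring

lemma prefactor_two (n : ℕ) : prefactor 2 n = invPoch (a * q) (q ^ 2) n := by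
  induction n with
  | zero => simp [prefactor]
  | succ n ih => rw [← mul_shift_prefactor, ih, mul_shift_invPoch_two]

lemma prefactor_three (n : ℕ) :
    prefactor 3 n = poch a (q ^ 3) n * invPoch a q (3 * n) := by
  induction n with
  | zero => simp [prefactor]
  | succ n ih =>
    rw [← mul_shift_prefactor, ih, shift_mul, mul_shift_poch_mul_invPoch_three, mul_add, mul_one]

lemma invPoch_add_eq_prefactor (n j : ℕ) :
    invPoch (a * q) (q ^ 2) (n + j) =
      prefactor 2 n * shift (2 * n) (invPoch (a * q) (q ^ 2) j) := by
  rw [prefactor_two, shift_invPoch _ _ (by simp), invPoch_add _ (by simp)]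
  simp only [shift_mul, shift_a, shift_q, shift_pow]
  congr 2
  ring

lemma poch_mul_invPoch_add_eq_prefactor (n i j : ℕ) :
    poch a (q ^ 3) (n + i) * invPoch a q (3 * n + j) =
      prefactor 3 n * (shift (3 * n) (poch a (q ^ 3) i) * shift (3 * n) (invPoch a q j)) := by
  rw [prefactor_three, shift_invPoch _ _ (by simp), shift_poch, invPoch_add _ (by simp), poch_add]
  simp only [shift_a, shift_q, shift_pow, ← pow_mul]
  ring

/-! ### The equations of the system after a substitution `a ↦ a q^(dj)` -/

lemma QDiffSystem.shift_first {d k : ℕ} {G : ℕ → DSeries} (h : QDiffSystem d k G) (j : ℕ) :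
    shift (d * j) (G 1) =
      shift (d * j) (invPoch (a * q) q (d - 1)) * shift (d * (j + 1)) (G k) := by
  rw [h.1, shift_mul, shift_shift, mul_add, mul_one]

lemma QDiffSystem.shift_step {d k : ℕ} {G : ℕ → DSeries} (h : QDiffSystem d k G) (j : ℕ) {i l : ℕ}
    (hi : 1 ≤ i) (hl : 1 ≤ l) (hil : i + l = k) :
    shift (d * j) (G (i + 1)) = shift (d * j) (G i) +
      a ^ i * q ^ (d * ((j + 1) * i)) * shift (d * j) (invPoch (a * q) q (d - 1)) *
        shift (d * (j + 1)) (G l) := by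
  have e : k - (i + 1) + 1 = l := by omega
  rw [h.2 (i + 1) (by omega) (by omega), Nat.add_sub_cancel, e]
  simp only [shift_add, shift_mul, shift_pow, shift_a, shift_q, shift_shift, mul_add, mul_one]
  ring

/-- The general term of the series over `r`: a monomial factor `c`, the product of the first `2r`
factors `1 / (a q^(dj+1); q)_(d-1)`, the factor `1 / (q^d; q^d)_r`, and the function `G` at
`a q^(2dr)`. -/
noncomputable def rTerm (d : ℕ) (c : DSeries) (r : ℕ) (G : DSeries) : DSeries :=
  c * prefactor d (2 * r) * invPoch (q ^ d) (q ^ d) r * shift (d * (2 * r)) G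

lemma dvd_rTerm {d r : ℕ} {c : DSeries} (h : a ^ r ∣ c) (G : DSeries) : a ^ r ∣ rTerm d c r G :=
  ((h.mul_right _).mul_right _).mul_right _

lemma mul_shift_rTerm {d : ℕ} (hd : 1 ≤ d) (c : DSeries) (r : ℕ) (G : DSeries) :
    invPoch (a * q) q (d - 1) * shift d (rTerm d c r G) =
      shift d c * prefactor d (2 * r) * shift (d * (2 * r)) (invPoch (a * q) q (d - 1)) *
        invPoch (q ^ d) (q ^ d) r * shift (d * (2 * r + 1)) G := by
  have h := mul_shift_prefactor d (2 * r)
  rw [prefactor_succ] at h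
  have e : d + d * (2 * r) = d * (2 * r + 1) := by ring
  simp only [rTerm, shift_mul, shift_invPoch_q _ _ _ hd, shift_shift, e]
  linear_combination shift d c * invPoch (q ^ d) (q ^ d) r * shift (d * (2 * r + 1)) G * h

lemma rTerm_succ {d : ℕ} (hd : 1 ≤ d) (c : DSeries) (r : ℕ) (G : DSeries) :
    (1 - q ^ (d * (r + 1))) * rTerm d c (r + 1) G =
      c * prefactor d (2 * r) * shift (d * (2 * r)) (invPoch (a * q) q (d - 1)) *
        shift (d * (2 * r + 1)) (invPoch (a * q) q (d - 1)) *
        invPoch (q ^ d) (q ^ d) r * shift (d * (2 * r + 1 + 1)) G := by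
  have h := invPoch_succ (x := q ^ d) (q ^ d) (by simp; omega) r
  have e1 : 2 * (r + 1) = 2 * r + 1 + 1 := by ring
  have e2 : q ^ d * (q ^ d) ^ r = q ^ (d * (r + 1)) := by ring
  rw [e2] at h
  rw [rTerm, e1, prefactor_succ, prefactor_succ, ← h]
  ring

/-! ### The case `(d, k) = (2, 4)` -/

lemma hasSum_F241 : HasSum (fun r => rTerm 2 (a ^ (3 * r) * q ^ (6 * r ^ 2 + 6 * r)) r (F 2 3 1))
    F241 := by
  refine hasSum_of_hasSum_inner one_le_two (fun m r => ?_) fun r => ?_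
  · simp only [mul_assoc]
    exact (pow_dvd_pow a (by omega)).mul_right _
  · refine hasSum_of_eq ((hasSum_shift hasSum_F231 (2 * (2 * r))).mul_left _) fun m => ?_
    have e := invPoch_add_eq_prefactor (2 * r) (m + 1)
    have i1 : 2 * r + (m + 1) = m + 2 * r + 1 := by ring
    rw [i1] at e
    rw [e, Nat.add_sub_cancel]
    simp only [shift_mul, shift_pow, shift_a, shift_q, shift_invPoch_q_q]
    ring

lemma hasSum_F242 : HasSum (fun r => rTerm 2
    (a ^ (3 * r) * q ^ (6 * r ^ 2 + 6 * r) * (1 + a * q ^ (2 * r + 2))) r (F 2 3 1)) F242 := by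
  refine hasSum_of_hasSum_inner one_le_two (fun m r => ?_) fun r => ?_
  · simp only [mul_assoc]
    exact (pow_dvd_pow a (by omega)).mul_right _
  · refine hasSum_of_eq ((hasSum_shift hasSum_F231 (2 * (2 * r))).mul_left _) fun m => ?_
    have e := invPoch_add_eq_prefactor (2 * r) (m + 1)
    have i1 : 2 * r + (m + 1) = m + 2 * r + 1 := by ring
    rw [i1] at e
    rw [e, Nat.add_sub_cancel]
    simp only [shift_mul, shift_pow, shift_a, shift_q, shift_invPoch_q_q]
    ring

lemma hasSum_F243 : HasSum (fun r => rTerm 2 (a ^ (3 * r) * q ^ (6 * r ^ 2 + 2 * r)) r (F 2 3 3))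
    F243 := by
  refine hasSum_of_hasSum_inner one_le_two (fun m r => ?_) fun r => ?_
  · simp only [mul_assoc]
    exact (pow_dvd_pow a (by omega)).mul_right _
  · refine hasSum_of_eq ((hasSum_shift hasSum_F233 (2 * (2 * r))).mul_left _) fun m => ?_
    have e := invPoch_add_eq_prefactor (2 * r) m
    rw [add_comm] at e
    rw [e, Nat.add_sub_cancel]
    simp only [shift_mul, shift_pow, shift_a, shift_q, shift_invPoch_q_q]
    ring

lemma hasSum_F244 : HasSum (fun r => rTerm 2 (a ^ (3 * r) * q ^ (6 * r ^ 2)) r (F 2 3 3)) F244 := by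
  refine hasSum_of_hasSum_inner one_le_two (fun m r => ?_) fun r => ?_
  · simp only [mul_assoc]
    exact (pow_dvd_pow a (by omega)).mul_right _
  · refine hasSum_of_eq ((hasSum_shift hasSum_F233 (2 * (2 * r))).mul_left _) fun m => ?_
    have e := invPoch_add_eq_prefactor (2 * r) m
    rw [add_comm] at e
    rw [e, Nat.add_sub_cancel]
    simp only [shift_mul, shift_pow, shift_a, shift_q, shift_invPoch_q_q]
    ring

lemma F24_eq_one : F241 = invPoch (a * q) q (2 - 1) * shift 2 F244 := by
  refine hasSum_F241.unique
    (hasSum_of_eq ((hasSum_shift hasSum_F244 2).mul_left _) fun r => ?_)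
  rw [mul_shift_rTerm one_le_two, rTerm, F23_system.shift_first]
  simp only [shift_mul, shift_pow, shift_a, shift_q]
  ring

/-- By the first equation of the case `(2, 3)` the two sides agree term by term in `r`. -/
lemma F24_eq_two : F242 = F241 + a * q ^ 2 * invPoch (a * q) q (2 - 1) * shift 2 F243 := by
  have h := eq_zero_of_telescoping ((hasSum_F242.sub hasSum_F241).sub
      ((hasSum_shift hasSum_F243 2).mul_left (a * q ^ 2 * invPoch (a * q) q (2 - 1))))
    (fun _ => 0) (fun r => dvd_zero _) rfl fun r => ?_
  · linear_combination h
  · have hS := mul_shift_rTerm one_le_two (a ^ (3 * r) * q ^ (6 * r ^ 2 + 2 * r)) r (F 2 3 3)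
    have h1 := F23_system.shift_first (2 * r)
    simp only [shift_mul, shift_pow, shift_a, shift_q] at hS
    simp only [mul_assoc] at hS ⊢
    rw [hS]
    simp only [rTerm, h1]
    ring

/-- The telescoping sum combines the functions `G_1` and `G_3` of the case `(2, 3)`. -/
lemma F24_eq_three : F243 = F242 + a ^ 2 * q ^ 4 * invPoch (a * q) q (2 - 1) * shift 2 F242 := by
  have h := eq_zero_of_telescoping ((hasSum_F243.sub hasSum_F242).sub
      ((hasSum_shift hasSum_F242 2).mul_left (a ^ 2 * q ^ 4 * invPoch (a * q) q (2 - 1))))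
    (fun r => (1 - q ^ (2 * r)) * rTerm 2 (a ^ (3 * r) * q ^ (6 * r ^ 2 + 4 * r)) r (F 2 3 1) +
      (1 - q ^ (2 * r)) * rTerm 2 (a ^ (3 * r) * q ^ (6 * r ^ 2 + 2 * r)) r (F 2 3 3))
    (fun r => dvd_add
      (dvd_mul_of_dvd_right (dvd_rTerm ((pow_dvd_pow a (by omega)).mul_right _) _) _)
      (dvd_mul_of_dvd_right (dvd_rTerm ((pow_dvd_pow a (by omega)).mul_right _) _) _))
    (by simp) fun r => ?_
  · linear_combination h
  · have hS := mul_shift_rTerm one_le_two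
      (a ^ (3 * r) * q ^ (6 * r ^ 2 + 6 * r) * (1 + a * q ^ (2 * r + 2))) r (F 2 3 1)
    -- The equations at `a q^(2dr)` (`h1` onwards), then those at `a q^((2r+1)d)` (`k1` onwards),
    -- express both sides through the values `G_j(a q^((2r+2)d))`.
    have h1 := F23_system.shift_first (2 * r)
    have h2 := F23_system.shift_step (2 * r) (i := 1) (l := 2) (by omega) (by omega) rfl
    have h3 := F23_system.shift_step (2 * r) (i := 2) (l := 1) (by omega) (by omega) rfl
    have k1 := F23_system.shift_first (2 * r + 1)
    have k2 := F23_system.shift_step (2 * r + 1) (i := 1) (l := 2) (by omega) (by omega) rfl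
    have k3 := F23_system.shift_step (2 * r + 1) (i := 2) (l := 1) (by omega) (by omega) rfl
    simp only [Nat.reduceAdd] at h2 h3 k2 k3
    simp only [shift_add, shift_one, shift_mul, shift_pow, shift_a, shift_q] at hS
    simp only [rTerm_succ one_le_two]
    rw [mul_assoc (a ^ 2 * q ^ 4), hS]
    simp only [rTerm, h3, h2, h1, k3, k2, k1]
    ring

lemma F24_eq_four : F244 = F243 + a ^ 3 * q ^ 6 * invPoch (a * q) q (2 - 1) * shift 2 F241 := by
  have h := eq_zero_of_telescoping ((hasSum_F244.sub hasSum_F243).sub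
      ((hasSum_shift hasSum_F241 2).mul_left (a ^ 3 * q ^ 6 * invPoch (a * q) q (2 - 1))))
    (fun r => (1 - q ^ (2 * r)) * rTerm 2 (a ^ (3 * r) * q ^ (6 * r ^ 2)) r (F 2 3 3))
    (fun r => dvd_mul_of_dvd_right (dvd_rTerm ((pow_dvd_pow a (by omega)).mul_right _) _) _)
    (by simp) fun r => ?_
  · linear_combination h
  · have hS := mul_shift_rTerm one_le_two (a ^ (3 * r) * q ^ (6 * r ^ 2 + 6 * r)) r (F 2 3 1)
    have k1 := F23_system.shift_first (2 * r + 1)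
    simp only [shift_mul, shift_pow, shift_a, shift_q] at hS
    simp only [rTerm_succ one_le_two]
    rw [mul_assoc (a ^ 3 * q ^ 6), hS]
    simp only [rTerm, k1]
    ring

lemma F24_system : QDiffSystem 2 4 (F 2 4) := by
  refine ⟨F24_eq_one, fun i h2 hi => ?_⟩
  interval_cases i
  · simpa [F] using F24_eq_two
  · simpa [F] using F24_eq_three
  · simpa [F] using F24_eq_four

lemma F24_initial : InitialValues 4 (F 2 4) := by
  intro i h1 h2
  have hd : ∀ r, a ^ r ∣ a ^ (3 * r) := fun r => pow_dvd_pow a (by omega)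
  have i1 := F23_initial 1 le_rfl (by omega)
  have i3 := F23_initial 3 (by omega) le_rfl
  interval_cases i
  · exact (atZero_of_hasSum hasSum_F241 fun r => dvd_rTerm ((hd r).mul_right _) _).trans
      (by simp [rTerm, prefactor, i1])
  · exact (atZero_of_hasSum hasSum_F242
      fun r => dvd_rTerm (((hd r).mul_right _).mul_right _) _).trans
      (by simp [rTerm, prefactor, i1, atZero_add])
  · exact (atZero_of_hasSum hasSum_F243 fun r => dvd_rTerm ((hd r).mul_right _) _).trans
      (by simp [rTerm, prefactor, i3])
  · exact (atZero_of_hasSum hasSum_F244 fun r => dvd_rTerm ((hd r).mul_right _) _).trans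
      (by simp [rTerm, prefactor, i3])

/-! ### The case `(d, k) = (3, 5)` -/

lemma a_ne_zero : a ≠ 0 := PowerSeries.X_ne_zero

lemma q_ne_zero : q ≠ 0 := by
  intro h
  have := congrArg (PowerSeries.coeff 0) h
  simp [q, PowerSeries.X_ne_zero] at this

lemma mono353_add (m r : ℕ) :
    mono353 (m + 3 * r) r = a ^ m * q ^ (m ^ 2 + 6 * m * r) * mono353 (3 * r) r := by
  refine mul_left_cancel₀ (mul_ne_zero a_ne_zero (pow_ne_zero 3 q_ne_zero)) ?_
  have h := a_mul_mono353 (3 * r) r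
  rw [a_mul_mono353]
  linear_combination -(a ^ m * q ^ (m ^ 2 + 6 * m * r)) * h

lemma a_pow_dvd_mono353 (r : ℕ) : a ^ r ∣ mono353 (3 * r) r := by
  rcases Nat.eq_zero_or_pos r with rfl | hr
  · simp
  · exact dvd_sub ((pow_dvd_pow a (by omega)).mul_right _)
      (((pow_dvd_pow a (by omega)).mul_right _).mul_right _)

lemma hasSum_F351 : HasSum (fun r => rTerm 3 (a ^ (4 * r) * q ^ (12 * r ^ 2 + 12 * r)) r (F 3 4 1))
    F351 := by
  refine hasSum_of_hasSum_inner (by norm_num) (fun m r => ?_) fun r => ?_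
  · simp only [mul_assoc]
    exact (pow_dvd_pow a (by omega)).mul_right _
  · refine hasSum_of_eq ((hasSum_shift hasSum_F341 (3 * (2 * r))).mul_left _) fun m => ?_
    have e := poch_mul_invPoch_add_eq_prefactor (2 * r) (m + 1) (2 * m + 3)
    have e0 := poch_mul_invPoch_eq (m + 2 * r) (2 * (m + 3 * r) + 2)
    have i1 : m + 3 * r - r = m + 2 * r := by omega
    have i2 : 2 * r + (m + 1) = m + 2 * r + 1 := by ring
    have i3 : 3 * (2 * r) + (2 * m + 3) = 2 * (m + 3 * r) + 2 + 1 := by ring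
    rw [i2, i3, ← e0] at e
    rw [i1, Nat.add_sub_cancel]
    simp only [shift_mul, shift_pow, shift_a, shift_q, shift_invPoch_q_q]
    linear_combination a ^ (m + 3 * r + r) *
      q ^ ((m + 3 * r) ^ 2 + 3 * r ^ 2 + 3 * (m + 3 * r) + 3 * r) * invPoch q q m *
      invPoch (q ^ 3) (q ^ 3) r * e

lemma hasSum_F352 : HasSum (fun r => rTerm 3
    (a ^ (4 * r) * q ^ (12 * r ^ 2 + 12 * r) * (1 + a * q ^ (3 * r + 3))) r (F 3 4 1)) F352 := by
  refine hasSum_of_hasSum_inner (by norm_num) (fun m r => ?_) fun r => ?_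
  · simp only [mul_assoc]
    exact (pow_dvd_pow a (by omega)).mul_right _
  · refine hasSum_of_eq ((hasSum_shift hasSum_F341 (3 * (2 * r))).mul_left _) fun m => ?_
    have e := poch_mul_invPoch_add_eq_prefactor (2 * r) (m + 1) (2 * m + 3)
    have e0 := poch_mul_invPoch_eq (m + 2 * r) (2 * (m + 3 * r) + 2)
    have i1 : m + 3 * r - r = m + 2 * r := by omega
    have i2 : 2 * r + (m + 1) = m + 2 * r + 1 := by ring
    have i3 : 3 * (2 * r) + (2 * m + 3) = 2 * (m + 3 * r) + 2 + 1 := by ring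
    rw [i2, i3, ← e0] at e
    rw [i1, Nat.add_sub_cancel]
    simp only [shift_mul, shift_pow, shift_a, shift_q, shift_invPoch_q_q]
    linear_combination a ^ (m + 3 * r + r) *
      q ^ ((m + 3 * r) ^ 2 + 3 * r ^ 2 + 3 * (m + 3 * r) + 3 * r) * (1 + a * q ^ (3 * r + 3)) *
      invPoch q q m * invPoch (q ^ 3) (q ^ 3) r * e

/-- A double sum over `poch a (q^3) (n - r) / (a; q)_(2n)` with inner sums `G_4(a q^(6r))`, where
`G_4` belongs to the case `(3, 4)`. -/
lemma hasSum_inner_F344 {c : ℕ → ℕ → DSeries} {c' : ℕ → DSeries}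
    (hc : ∀ m r, c (m + 3 * r) r = a ^ m * q ^ (m ^ 2 + 6 * m * r) * c' r)
    (hc' : ∀ r, a ^ r ∣ c' r) :
    HasSum (fun r => rTerm 3 (c' r) r (F 3 4 4)) (∑' n, ∑ r ∈ Finset.range (n / 3 + 1),
      c n r * poch a (q ^ 3) (n - r) * invPoch a q (2 * n) * invPoch q q (n - 3 * r) *
        invPoch (q ^ 3) (q ^ 3) r) := by
  refine hasSum_of_hasSum_inner (by norm_num) (fun m r => ?_) fun r => ?_
  · have h : a ^ (m + r) ∣ c (m + 3 * r) r := by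
      rw [hc, pow_add]
      exact mul_dvd_mul (dvd_mul_right _ _) (hc' r)
    exact (((h.mul_right _).mul_right _).mul_right _).mul_right _
  · refine hasSum_of_eq ((hasSum_shift hasSum_F344 (3 * (2 * r))).mul_left _) fun m => ?_
    have e := poch_mul_invPoch_add_eq_prefactor (2 * r) m (2 * m)
    have i1 : m + 3 * r - r = m + 2 * r := by omega
    have i3 : 3 * (2 * r) + 2 * m = 2 * (m + 3 * r) := by ring
    rw [add_comm (2 * r), i3] at e
    rw [i1, Nat.add_sub_cancel, hc]
    simp only [shift_mul, shift_pow, shift_a, shift_q, shift_invPoch_q_q]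
    linear_combination a ^ m * q ^ (m ^ 2 + 6 * m * r) * c' r * invPoch q q m *
      invPoch (q ^ 3) (q ^ 3) r * e

lemma hasSum_F353 : HasSum (fun r => rTerm 3 (mono353 (3 * r) r) r (F 3 4 4)) F353 :=
  hasSum_inner_F344 mono353_add a_pow_dvd_mono353

lemma hasSum_F354 : HasSum (fun r => rTerm 3 (a ^ (4 * r) * q ^ (12 * r ^ 2 + 3 * r)) r (F 3 4 4))
    F354 :=
  hasSum_inner_F344 (c := fun n r => a ^ (n + r) * q ^ (n ^ 2 + 3 * r ^ 2 + 3 * r))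
    (fun m r => by ring) fun r => (pow_dvd_pow a (by omega)).mul_right _

lemma hasSum_F355 : HasSum (fun r => rTerm 3 (a ^ (4 * r) * q ^ (12 * r ^ 2)) r (F 3 4 4)) F355 :=
  hasSum_inner_F344 (c := fun n r => a ^ (n + r) * q ^ (n ^ 2 + 3 * r ^ 2))
    (fun m r => by ring) fun r => (pow_dvd_pow a (by omega)).mul_right _

lemma one_le_three : 1 ≤ 3 := by norm_num

lemma F35_eq_one : F351 = invPoch (a * q) q (3 - 1) * shift 3 F355 := by
  refine hasSum_F351.unique
    (hasSum_of_eq ((hasSum_shift hasSum_F355 3).mul_left _) fun r => ?_)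
  rw [mul_shift_rTerm one_le_three, rTerm, F34_system.shift_first]
  simp only [shift_mul, shift_pow, shift_a, shift_q]
  ring

/-- By the first equation of the case `(3, 4)` the two sides agree term by term in `r`. -/
lemma F35_eq_two : F352 = F351 + a * q ^ 3 * invPoch (a * q) q (3 - 1) * shift 3 F354 := by
  have h := eq_zero_of_telescoping ((hasSum_F352.sub hasSum_F351).sub
      ((hasSum_shift hasSum_F354 3).mul_left (a * q ^ 3 * invPoch (a * q) q (3 - 1))))
    (fun _ => 0) (fun r => dvd_zero _) rfl fun r => ?_
  · linear_combination h
  · have hS := mul_shift_rTerm one_le_three (a ^ (4 * r) * q ^ (12 * r ^ 2 + 3 * r)) r (F 3 4 4)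
    have h1 := F34_system.shift_first (2 * r)
    simp only [shift_mul, shift_pow, shift_a, shift_q] at hS
    rw [mul_assoc (a * q ^ 3), hS]
    simp only [rTerm, h1]
    ring

/-- The telescoping sum combines the functions `G_1`, `G_2` and `G_4` of the case `(3, 4)`. -/
lemma F35_eq_three : F353 = F352 + a ^ 2 * q ^ 6 * invPoch (a * q) q (3 - 1) * shift 3 F353 := by
  -- The factor `a * q ^ 3` clears the negative powers in the monomials of `F353`.
  have h := eq_zero_of_telescoping (((hasSum_F353.sub hasSum_F352).sub
      ((hasSum_shift hasSum_F353 3).mul_left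
        (a ^ 2 * q ^ 6 * invPoch (a * q) q (3 - 1)))).mul_left (a * q ^ 3))
    (fun r => (1 - q ^ (3 * r)) * rTerm 3
        (a ^ (4 * r) * (a * q ^ 3 * q ^ (12 * r ^ 2 + 9 * r) * (1 + a * q ^ (3 * r)))) r (F 3 4 1) +
      (1 - q ^ (3 * r)) * rTerm 3
        (a ^ (4 * r) * (a * q ^ 3 * q ^ (12 * r ^ 2 + 6 * r))) r (F 3 4 2) +
      (1 - q ^ (3 * r)) * rTerm 3 (a ^ (4 * r) * -q ^ (12 * r ^ 2)) r (F 3 4 4))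
    (fun r => dvd_add (dvd_add
      (dvd_mul_of_dvd_right (dvd_rTerm ((pow_dvd_pow a (by omega)).mul_right _) _) _)
      (dvd_mul_of_dvd_right (dvd_rTerm ((pow_dvd_pow a (by omega)).mul_right _) _) _))
      (dvd_mul_of_dvd_right (dvd_rTerm ((pow_dvd_pow a (by omega)).mul_right _) _) _))
    (by simp) fun r => ?_
  · have h' := (mul_eq_zero.1 h).resolve_left (mul_ne_zero a_ne_zero (pow_ne_zero 3 q_ne_zero))
    linear_combination h'
  · have hS := mul_shift_rTerm one_le_three (mono353 (3 * r) r) r (F 3 4 4)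
    have hM := a_mul_mono353 (3 * r) r
    have hM' := congrArg (shift 3) hM
    simp only [shift_add, shift_sub, shift_one, shift_mul, shift_pow, shift_a, shift_q] at hM'
    have key : a * q ^ 3 * (rTerm 3 (mono353 (3 * r) r) r (F 3 4 4) - rTerm 3
        (a ^ (4 * r) * q ^ (12 * r ^ 2 + 12 * r) * (1 + a * q ^ (3 * r + 3))) r (F 3 4 1) -
        a ^ 2 * q ^ 6 * invPoch (a * q) q (3 - 1) *
          shift 3 (rTerm 3 (mono353 (3 * r) r) r (F 3 4 4))) =
        a ^ (4 * r) * q ^ (12 * r ^ 2) * prefactor 3 (2 * r) * invPoch (q ^ 3) (q ^ 3) r *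
          ((q ^ (3 * r) + a * q ^ (6 * r + 3) - 1) * shift (3 * (2 * r)) (F 3 4 4) -
          a * q ^ 3 * q ^ (12 * r) * (1 + a * q ^ (3 * r + 3)) * shift (3 * (2 * r)) (F 3 4 1) -
          a ^ 2 * q ^ 3 * q ^ (12 * r) * (q ^ (3 * r) + a * q ^ (6 * r + 6) - 1) *
            shift (3 * (2 * r)) (invPoch (a * q) q (3 - 1)) *
            shift (3 * (2 * r + 1)) (F 3 4 4)) := by
      rw [mul_assoc (a ^ 2 * q ^ 6), hS, rTerm, rTerm]
      linear_combination prefactor 3 (2 * r) * invPoch (q ^ 3) (q ^ 3) r *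
        shift (3 * (2 * r)) (F 3 4 4) * hM - a ^ 2 * q ^ 3 * prefactor 3 (2 * r) *
        invPoch (q ^ 3) (q ^ 3) r * shift (3 * (2 * r)) (invPoch (a * q) q (3 - 1)) *
        shift (3 * (2 * r + 1)) (F 3 4 4) * hM'
    -- The equations at `a q^(2dr)` (`h1` onwards), then those at `a q^((2r+1)d)` (`k1` onwards),
    -- express both sides through the values `G_j(a q^((2r+2)d))`.
    have h1 := F34_system.shift_first (2 * r)
    have h2 := F34_system.shift_step (2 * r) (i := 1) (l := 3) (by omega) (by omega) rfl
    have h3 := F34_system.shift_step (2 * r) (i := 2) (l := 2) (by omega) (by omega) rfl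
    have h4 := F34_system.shift_step (2 * r) (i := 3) (l := 1) (by omega) (by omega) rfl
    have k1 := F34_system.shift_first (2 * r + 1)
    have k2 := F34_system.shift_step (2 * r + 1) (i := 1) (l := 3) (by omega) (by omega) rfl
    have k3 := F34_system.shift_step (2 * r + 1) (i := 2) (l := 2) (by omega) (by omega) rfl
    have k4 := F34_system.shift_step (2 * r + 1) (i := 3) (l := 1) (by omega) (by omega) rfl
    simp only [Nat.reduceAdd] at h2 h3 h4 k2 k3 k4
    rw [key]
    simp only [rTerm_succ one_le_three]
    simp only [rTerm, h4, h3, h2, h1, k4, k3, k2, k1]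
    ring

lemma F35_eq_four : F354 = F353 + a ^ 3 * q ^ 9 * invPoch (a * q) q (3 - 1) * shift 3 F352 := by
  -- The factor `a * q ^ 3` clears the negative powers in the monomials of `F353`.
  have h := eq_zero_of_telescoping (((hasSum_F354.sub hasSum_F353).sub
      ((hasSum_shift hasSum_F352 3).mul_left
        (a ^ 3 * q ^ 9 * invPoch (a * q) q (3 - 1)))).mul_left (a * q ^ 3))
    (fun r => (1 - q ^ (3 * r)) * rTerm 3
        (a ^ (4 * r) * (q ^ (12 * r ^ 2) * (1 + a * q ^ (3 * r + 3)))) r (F 3 4 4))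
    (fun r => dvd_mul_of_dvd_right (dvd_rTerm ((pow_dvd_pow a (by omega)).mul_right _) _) _)
    (by simp) fun r => ?_
  · have h' := (mul_eq_zero.1 h).resolve_left (mul_ne_zero a_ne_zero (pow_ne_zero 3 q_ne_zero))
    linear_combination h'
  · have hS := mul_shift_rTerm one_le_three
      (a ^ (4 * r) * q ^ (12 * r ^ 2 + 12 * r) * (1 + a * q ^ (3 * r + 3))) r (F 3 4 1)
    have hM := a_mul_mono353 (3 * r) r
    have k1 := F34_system.shift_first (2 * r + 1)
    simp only [shift_add, shift_one, shift_mul, shift_pow, shift_a, shift_q] at hS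
    simp only [rTerm_succ one_le_three]
    rw [mul_assoc (a ^ 3 * q ^ 9), hS]
    simp only [rTerm, k1]
    linear_combination -prefactor 3 (2 * r) * invPoch (q ^ 3) (q ^ 3) r *
        shift (3 * (2 * r)) (F 3 4 4) * hM

lemma F35_eq_five : F355 = F354 + a ^ 4 * q ^ 12 * invPoch (a * q) q (3 - 1) * shift 3 F351 := by
  have h := eq_zero_of_telescoping ((hasSum_F355.sub hasSum_F354).sub
      ((hasSum_shift hasSum_F351 3).mul_left (a ^ 4 * q ^ 12 * invPoch (a * q) q (3 - 1))))
    (fun r => (1 - q ^ (3 * r)) * rTerm 3 (a ^ (4 * r) * q ^ (12 * r ^ 2)) r (F 3 4 4))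
    (fun r => dvd_mul_of_dvd_right (dvd_rTerm ((pow_dvd_pow a (by omega)).mul_right _) _) _)
    (by simp) fun r => ?_
  · linear_combination h
  · have hS := mul_shift_rTerm one_le_three (a ^ (4 * r) * q ^ (12 * r ^ 2 + 12 * r)) r (F 3 4 1)
    have k1 := F34_system.shift_first (2 * r + 1)
    simp only [shift_mul, shift_pow, shift_a, shift_q] at hS
    simp only [rTerm_succ one_le_three]
    rw [mul_assoc (a ^ 4 * q ^ 12), hS]
    simp only [rTerm, k1]
    ring

lemma F35_system : QDiffSystem 3 5 (F 3 5) := by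
  refine ⟨F35_eq_one, fun i h2 hi => ?_⟩
  interval_cases i
  · simpa [F] using F35_eq_two
  · simpa [F] using F35_eq_three
  · simpa [F] using F35_eq_four
  · simpa [F] using F35_eq_five

lemma F35_initial : InitialValues 5 (F 3 5) := by
  intro i h1 h2
  have hd : ∀ r, a ^ r ∣ a ^ (4 * r) := fun r => pow_dvd_pow a (by omega)
  have i1 := F34_initial 1 le_rfl (by omega)
  have i4 := F34_initial 4 (by omega) le_rfl
  interval_cases i
  · exact (atZero_of_hasSum hasSum_F351 fun r => dvd_rTerm ((hd r).mul_right _) _).trans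
      (by simp [rTerm, prefactor, i1])
  · exact (atZero_of_hasSum hasSum_F352
      fun r => dvd_rTerm (((hd r).mul_right _).mul_right _) _).trans
      (by simp [rTerm, prefactor, i1, atZero_add])
  · exact (atZero_of_hasSum hasSum_F353 fun r => dvd_rTerm (a_pow_dvd_mono353 r) _).trans
      (by simp [rTerm, prefactor, i4, mono353])
  · exact (atZero_of_hasSum hasSum_F354 fun r => dvd_rTerm ((hd r).mul_right _) _).trans
      (by simp [rTerm, prefactor, i4])
  · exact (atZero_of_hasSum hasSum_F355 fun r => dvd_rTerm ((hd r).mul_right _) _).trans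
      (by simp [rTerm, prefactor, i4])

/-! ### The case `(d, k) = (3, 3)` -/

lemma exponent_mono332 (m r : ℕ) :
    (2 * (m + 3 * r) ^ 2 + 3 * r ^ 2 - 9 * r) / 2 =
      m ^ 2 + 6 * m * r + (6 * r ^ 2 + 9 * r.choose 2) := by
  have h := two_mul_choose_two_add r
  have e : 2 * (m + 3 * r) ^ 2 + 3 * r ^ 2 =
      2 * (m ^ 2 + 6 * m * r + (6 * r ^ 2 + 9 * r.choose 2)) + 9 * r := by
    linear_combination 9 * h.symm
  rw [e, Nat.add_sub_cancel, Nat.mul_div_cancel_left _ two_pos]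

lemma a_mul_mono332_three_mul (r : ℕ) :
    a * mono332 (3 * r) r = a ^ (3 * r) * q ^ (6 * r ^ 2 + 9 * r.choose 2) *
      (1 + a * q ^ (3 * r) - q ^ (3 * r)) := by
  have e := exponent_mono332 0 r
  rw [zero_add] at e
  rw [a_mul_mono332 _ _ le_rfl, e]
  ring

lemma mono332_add (m r : ℕ) :
    mono332 (m + 3 * r) r = a ^ m * q ^ (m ^ 2 + 6 * m * r) * mono332 (3 * r) r := by
  refine mul_left_cancel₀ a_ne_zero ?_
  have h := a_mul_mono332_three_mul r
  rw [a_mul_mono332 _ _ (by omega), exponent_mono332]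
  linear_combination -(a ^ m * q ^ (m ^ 2 + 6 * m * r)) * h

lemma a_pow_dvd_mono332 (r : ℕ) : a ^ r ∣ mono332 (3 * r) r := by
  rcases Nat.eq_zero_or_pos r with rfl | hr
  · simp
  · exact dvd_add ((pow_dvd_pow a (by omega)).mul_right _)
      (((pow_dvd_pow a (by omega)).mul_right _).mul_right _)

lemma exponent_F333 (m r : ℕ) : (m + 3 * r) ^ 2 + 3 * r * (r - 1) / 2 =
    m ^ 2 + 6 * m * r + (6 * r ^ 2 + 9 * r.choose 2 + 3 * r) := by
  have h := two_mul_choose_two_add r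
  have e : 3 * r * (r - 1) / 2 = 3 * r.choose 2 := by
    rw [Nat.choose_two_right, mul_assoc, Nat.mul_div_assoc]
    exact (Nat.even_mul_pred_self r).two_dvd
  rw [e]
  linear_combination 3 * h.symm

lemma hasSum_F331 : HasSum (fun r => rTerm 3
    ((-1) ^ r * a ^ (3 * r) * q ^ (6 * r ^ 2 + 9 * r.choose 2 + 12 * r)) r (F 3 4 1)) F331 := by
  refine hasSum_of_hasSum_inner (by norm_num) (fun m r => ?_) fun r => ?_
  · simp only [mul_assoc]
    exact ((pow_dvd_pow a (by omega)).mul_right _).mul_left _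
  · refine hasSum_of_eq ((hasSum_shift hasSum_F341 (3 * (2 * r))).mul_left _) fun m => ?_
    have e := poch_mul_invPoch_add_eq_prefactor (2 * r) (m + 1) (2 * m + 3)
    have e0 := poch_mul_invPoch_eq (m + 2 * r) (2 * (m + 3 * r) + 2)
    have i1 : m + 3 * r - r = m + 2 * r := by omega
    have i2 : 2 * r + (m + 1) = m + 2 * r + 1 := by ring
    have i3 : 3 * (2 * r) + (2 * m + 3) = 2 * (m + 3 * r) + 2 + 1 := by ring
    have i4 : (m + 3 * r) ^ 2 + 3 * (m + 3 * r) + 3 * r * (r - 1) / 2 =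
        m ^ 2 + 6 * m * r + (6 * r ^ 2 + 9 * r.choose 2 + 3 * r) + 3 * (m + 3 * r) := by
      rw [← exponent_F333]
      ring
    rw [i2, i3, ← e0] at e
    rw [i1, i4, Nat.add_sub_cancel]
    simp only [shift_mul, shift_pow, shift_a, shift_q, shift_invPoch_q_q]
    linear_combination (-1) ^ r * a ^ (m + 3 * r) *
      q ^ (m ^ 2 + 6 * m * r + (6 * r ^ 2 + 9 * r.choose 2 + 3 * r) + 3 * (m + 3 * r)) *
      invPoch q q m * invPoch (q ^ 3) (q ^ 3) r * e

lemma hasSum_F332 : HasSum (fun r => rTerm 3 ((-1) ^ r * mono332 (3 * r) r) r (F 3 4 4)) F332 :=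
  hasSum_inner_F344 (c := fun n r => (-1) ^ r * mono332 n r)
    (fun m r => by rw [mono332_add]; ring) fun r => (a_pow_dvd_mono332 r).mul_left _

lemma hasSum_F333 : HasSum (fun r => rTerm 3
    ((-1) ^ r * a ^ (3 * r) * q ^ (6 * r ^ 2 + 9 * r.choose 2 + 3 * r)) r (F 3 4 4)) F333 :=
  hasSum_inner_F344 (c := fun n r => (-1) ^ r * a ^ n * q ^ (n ^ 2 + 3 * r * (r - 1) / 2))
    (fun m r => by rw [exponent_F333]; ring)
    fun r => ((pow_dvd_pow a (by omega)).mul_left _).mul_right _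

lemma F33_eq_one : F331 = invPoch (a * q) q (3 - 1) * shift 3 F333 := by
  refine hasSum_F331.unique
    (hasSum_of_eq ((hasSum_shift hasSum_F333 3).mul_left _) fun r => ?_)
  rw [mul_shift_rTerm one_le_three, rTerm, F34_system.shift_first]
  simp only [shift_mul, shift_pow, shift_neg, shift_one, shift_a, shift_q]
  ring

/-- The telescoping sum combines the functions `G_1`, `G_3` and `G_4` of the case `(3, 4)`. -/
lemma F33_eq_two : F332 = F331 + a * q ^ 3 * invPoch (a * q) q (3 - 1) * shift 3 F332 := by
  -- The factor `a` clears the negative powers in the monomials of `F332`.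
  have h := eq_zero_of_telescoping (((hasSum_F332.sub hasSum_F331).sub
      ((hasSum_shift hasSum_F332 3).mul_left
        (a * q ^ 3 * invPoch (a * q) q (3 - 1)))).mul_left a)
    (fun r => (1 - q ^ (3 * r)) * rTerm 3 (a ^ (3 * r) * ((-1) ^ r *
        (-a ^ 2 * q ^ 3 * q ^ (6 * r ^ 2 + 9 * r.choose 2 + 12 * r)))) r (F 3 4 1) +
      (1 - q ^ (3 * r)) * rTerm 3 (a ^ (3 * r) * ((-1) ^ r *
        (a * q ^ (6 * r ^ 2 + 9 * r.choose 2 + 6 * r)))) r (F 3 4 3) +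
      (1 - q ^ (3 * r)) * rTerm 3 (a ^ (3 * r) * ((-1) ^ r *
        (q ^ (6 * r ^ 2 + 9 * r.choose 2) * (1 + a * q ^ (3 * r))))) r (F 3 4 4))
    (fun r => dvd_add (dvd_add
      (dvd_mul_of_dvd_right (dvd_rTerm ((pow_dvd_pow a (by omega)).mul_right _) _) _)
      (dvd_mul_of_dvd_right (dvd_rTerm ((pow_dvd_pow a (by omega)).mul_right _) _) _))
      (dvd_mul_of_dvd_right (dvd_rTerm ((pow_dvd_pow a (by omega)).mul_right _) _) _))
    (by simp) fun r => ?_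
  · have h' := (mul_eq_zero.1 h).resolve_left a_ne_zero
    linear_combination h'
  · have hS := mul_shift_rTerm one_le_three ((-1) ^ r * mono332 (3 * r) r) r (F 3 4 4)
    have hM := a_mul_mono332_three_mul r
    have hM' := congrArg (shift 3) hM
    simp only [shift_add, shift_sub, shift_neg, shift_one, shift_mul, shift_pow, shift_a,
      shift_q] at hM' hS
    have key : a * (rTerm 3 ((-1) ^ r * mono332 (3 * r) r) r (F 3 4 4) - rTerm 3
        ((-1) ^ r * a ^ (3 * r) * q ^ (6 * r ^ 2 + 9 * r.choose 2 + 12 * r)) r (F 3 4 1) -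
        a * q ^ 3 * invPoch (a * q) q (3 - 1) *
          shift 3 (rTerm 3 ((-1) ^ r * mono332 (3 * r) r) r (F 3 4 4))) =
        (-1) ^ r * a ^ (3 * r) * q ^ (6 * r ^ 2 + 9 * r.choose 2) * prefactor 3 (2 * r) *
          invPoch (q ^ 3) (q ^ 3) r *
          ((1 + a * q ^ (3 * r) - q ^ (3 * r)) * shift (3 * (2 * r)) (F 3 4 4) -
          a * q ^ (12 * r) * shift (3 * (2 * r)) (F 3 4 1) -
          a * q ^ (9 * r) * (1 + a * q ^ (3 * r + 3) - q ^ (3 * r)) *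
            shift (3 * (2 * r)) (invPoch (a * q) q (3 - 1)) *
            shift (3 * (2 * r + 1)) (F 3 4 4)) := by
      rw [mul_assoc (a * q ^ 3), hS, rTerm, rTerm]
      linear_combination (-1) ^ r * prefactor 3 (2 * r) * invPoch (q ^ 3) (q ^ 3) r *
        shift (3 * (2 * r)) (F 3 4 4) * hM - a * (-1) ^ r * prefactor 3 (2 * r) *
        invPoch (q ^ 3) (q ^ 3) r * shift (3 * (2 * r)) (invPoch (a * q) q (3 - 1)) *
        shift (3 * (2 * r + 1)) (F 3 4 4) * hM'
    have hC : (r + 1).choose 2 = r + r.choose 2 := by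
      rw [Nat.choose_succ_succ' r 1, Nat.choose_one_right]
    -- The equations at `a q^(2dr)` (`h1` onwards), then those at `a q^((2r+1)d)` (`k1` onwards),
    -- express both sides through the values `G_j(a q^((2r+2)d))`.
    have h1 := F34_system.shift_first (2 * r)
    have h2 := F34_system.shift_step (2 * r) (i := 1) (l := 3) (by omega) (by omega) rfl
    have h3 := F34_system.shift_step (2 * r) (i := 2) (l := 2) (by omega) (by omega) rfl
    have h4 := F34_system.shift_step (2 * r) (i := 3) (l := 1) (by omega) (by omega) rfl
    have k1 := F34_system.shift_first (2 * r + 1)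
    have k2 := F34_system.shift_step (2 * r + 1) (i := 1) (l := 3) (by omega) (by omega) rfl
    have k3 := F34_system.shift_step (2 * r + 1) (i := 2) (l := 2) (by omega) (by omega) rfl
    have k4 := F34_system.shift_step (2 * r + 1) (i := 3) (l := 1) (by omega) (by omega) rfl
    simp only [Nat.reduceAdd] at h2 h3 h4 k2 k3 k4
    rw [key]
    simp only [rTerm_succ one_le_three, hC]
    simp only [rTerm, h4, h3, h2, h1, k4, k3, k2, k1]
    ring

lemma F33_eq_three : F333 = F332 + a ^ 2 * q ^ 6 * invPoch (a * q) q (3 - 1) * shift 3 F331 := by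
  -- The factor `a` clears the negative powers in the monomials of `F332`.
  have h := eq_zero_of_telescoping (((hasSum_F333.sub hasSum_F332).sub
      ((hasSum_shift hasSum_F331 3).mul_left
        (a ^ 2 * q ^ 6 * invPoch (a * q) q (3 - 1)))).mul_left a)
    (fun r => (1 - q ^ (3 * r)) * rTerm 3 (a ^ (3 * r) * ((-1) ^ r *
        -q ^ (6 * r ^ 2 + 9 * r.choose 2))) r (F 3 4 4))
    (fun r => dvd_mul_of_dvd_right (dvd_rTerm ((pow_dvd_pow a (by omega)).mul_right _) _) _)
    (by simp) fun r => ?_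
  · have h' := (mul_eq_zero.1 h).resolve_left a_ne_zero
    linear_combination h'
  · have hS := mul_shift_rTerm one_le_three
      ((-1) ^ r * a ^ (3 * r) * q ^ (6 * r ^ 2 + 9 * r.choose 2 + 12 * r)) r (F 3 4 1)
    have hM := a_mul_mono332_three_mul r
    have hC : (r + 1).choose 2 = r + r.choose 2 := by
      rw [Nat.choose_succ_succ' r 1, Nat.choose_one_right]
    have k1 := F34_system.shift_first (2 * r + 1)
    simp only [shift_mul, shift_pow, shift_neg, shift_one, shift_a, shift_q] at hS
    simp only [rTerm_succ one_le_three, hC]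
    rw [mul_assoc (a ^ 2 * q ^ 6), hS]
    simp only [rTerm, k1]
    linear_combination -(-1) ^ r * prefactor 3 (2 * r) * invPoch (q ^ 3) (q ^ 3) r *
        shift (3 * (2 * r)) (F 3 4 4) * hM

lemma F33_system : QDiffSystem 3 3 (F 3 3) := by
  refine ⟨F33_eq_one, fun i h2 hi => ?_⟩
  interval_cases i
  · simpa [F] using F33_eq_two
  · simpa [F] using F33_eq_three

lemma F33_initial : InitialValues 3 (F 3 3) := by
  intro i h1 h2
  have hd : ∀ r, a ^ r ∣ (-1) ^ r * a ^ (3 * r) := fun r =>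
    (pow_dvd_pow a (by omega)).mul_left _
  have i1 := F34_initial 1 le_rfl (by omega)
  have i4 := F34_initial 4 (by omega) le_rfl
  interval_cases i
  · exact (atZero_of_hasSum hasSum_F331 fun r => dvd_rTerm ((hd r).mul_right _) _).trans
      (by simp [rTerm, prefactor, i1])
  · exact (atZero_of_hasSum hasSum_F332
      fun r => dvd_rTerm ((a_pow_dvd_mono332 r).mul_left _) _).trans
      (by simp [rTerm, prefactor, i4, mono332])
  · exact (atZero_of_hasSum hasSum_F333 fun r => dvd_rTerm ((hd r).mul_right _) _).trans
      (by simp [rTerm, prefactor, i4])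

/-! ### The three families agree -/

theorem B_eq_Q {d k i : ℕ} (hd : 1 ≤ d) (hi : 1 ≤ i) (hik : i ≤ k) : B d k i = Q d k i :=
  (qDiffSystem_B hd (hi.trans hik)).unique hd (qDiffSystem_Q hd (hi.trans hik))
    (initialValues_B d k) (initialValues_Q d k) hi hik

theorem Q_eq_of_qDiffSystem {d k i : ℕ} {G : ℕ → DSeries} (hd : 1 ≤ d) (hi : 1 ≤ i) (hik : i ≤ k)
    (hG : QDiffSystem d k G) (hG0 : InitialValues k G) : Q d k i = G i :=
  (qDiffSystem_Q hd (hi.trans hik)).unique hd hG (initialValues_Q d k) hG0 hi hik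

end GenGordon

theorem mainTheorem2 :
    -- the product and the series that define `Q_{d,k,i}` converge
    (Multipliable fun j : ℕ => (1 : GenGordon.DSeries) - GenGordon.a * GenGordon.q * GenGordon.q ^ j) ∧
    (∀ d k i : ℕ, 1 ≤ d → 1 ≤ i → i ≤ k → Summable (GenGordon.QTerm d k i)) ∧
    -- both families satisfy the `q`-difference system and have the same initial values
    (∀ d k : ℕ, 1 ≤ d → 1 ≤ k →
      (GenGordon.QDiffSystem d k (GenGordon.B d k) ∧ GenGordon.InitialValues k (GenGordon.B d k)) ∧
      (GenGordon.QDiffSystem d k (GenGordon.Q d k) ∧ GenGordon.InitialValues k (GenGordon.Q d k))) ∧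
    -- hence they agree
    (∀ d k i : ℕ, 1 ≤ d → 1 ≤ i → i ≤ k → GenGordon.B d k i = GenGordon.Q d k i) ∧
    -- and they agree with `F_{d,k,i}` in the six special cases
    (∀ d k i : ℕ, (d, k) ∈ [(2, 2), (2, 3), (2, 4), (3, 3), (3, 4), (3, 5)] → 1 ≤ i → i ≤ k →
      GenGordon.B d k i = GenGordon.Q d k i ∧ GenGordon.Q d k i = GenGordon.F d k i) := by
  refine ⟨GenGordon.multipliable_pochInf,
    fun d k i _ hi hik => GenGordon.summable_QTerm (hi.trans hik) i,
    fun d k hd hk => ⟨⟨GenGordon.qDiffSystem_B hd hk, GenGordon.initialValues_B d k⟩,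
      GenGordon.qDiffSystem_Q hd hk, GenGordon.initialValues_Q d k⟩,
    fun d k i hd hi hik => GenGordon.B_eq_Q hd hi hik, fun d k i hdk hi hik => ?_⟩
  have hd : 1 ≤ d := by
    simp only [List.mem_cons, Prod.mk.injEq, List.not_mem_nil, or_false] at hdk
    omega
  refine ⟨GenGordon.B_eq_Q hd hi hik, ?_⟩
  simp only [List.mem_cons, Prod.mk.injEq, List.not_mem_nil, or_false] at hdk
  rcases hdk with ⟨rfl, rfl⟩ | ⟨rfl, rfl⟩ | ⟨rfl, rfl⟩ | ⟨rfl, rfl⟩ | ⟨rfl, rfl⟩ | ⟨rfl, rfl⟩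
  · exact GenGordon.Q_eq_of_qDiffSystem hd hi hik GenGordon.F22_system GenGordon.F22_initial
  · exact GenGordon.Q_eq_of_qDiffSystem hd hi hik GenGordon.F23_system GenGordon.F23_initial
  · exact GenGordon.Q_eq_of_qDiffSystem hd hi hik GenGordon.F24_system GenGordon.F24_initial
  · exact GenGordon.Q_eq_of_qDiffSystem hd hi hik GenGordon.F33_system GenGordon.F33_initial
  · exact GenGordon.Q_eq_of_qDiffSystem hd hi hik GenGordon.F34_system GenGordon.F34_initial
  · exact GenGordon.Q_eq_of_qDiffSystem hd hi hik GenGordon.F35_system GenGordon.F35_initial
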